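/- Fix an integer $n\ge 0$. Let $j$ be the chiral $U(1)$ current on the light-ray in its vacuum representation, with $\langle\Omega, j(x)j(y)\Omega\rangle=\frac1{4\pi^2}\int_0^\infty p\,e^{-ip(x-y)}\,dp$, and let $\Phi^{(n)}=\partial_x^n j$, so that $[\Phi^{(n)}(x),\Phi^{(n)}(y)]=\frac{i}{2\pi}(-1)^n\delta^{(2n+1)}(x-y)\mathbf 1$. For $f\in C^\infty(S^1)$ put $\widehat f(x)=2^n(1+z)^{-2n}f(z)=2^{-n}(1-ix)^{2n}f(z)$ with $z=\frac{1+ix}{1-ix}$, and let $\widetilde\Phi^{(n)}(f)=\Phi^{(n)}(\widehat f)$ be the conformally extended field on the circle, acting on its own vacuum Fock space (polynomials in the fields applied to the vacuum vector $\Omega$, with null vectors divided out), with the conformal Hamiltonian $L_0$ determined by $L_0\Omega=0$ and $[L_0,\widetilde\Phi^{(n)}(f)]=\widetilde\Phi^{(n)}(nf-zf')$. Then this field obeys the light-ray commutation relation $$[\widetilde\Phi^{(n)}(f),\widetilde\Phi^{(n)}(g)]=\tfrac{i}{2\pi}(-1)^n\int_{\mathbb R}\widehat f(x)\,\partial_x^{2n+1}\widehat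 g(x)\,dx\;\mathbf 1,\qquad f,g\in C^\infty(S^1),$$ and its modes $\Phi^{(n)}_m:=\widetilde\Phi^{(n)}(z^{n+m})$, $m\in\mathbb Z$, satisfy $$[\Phi^{(n)}_m,\Phi^{(n)}_{m'}]=\delta_{m,-m'}\,\Pi^{(n)}(m)\,\mathbf 1,\qquad \Pi^{(n)}(m):=\prod_{k=0}^{2n}(m-n+k).$$ The modes with $|m|\le n$ are central in the algebra generated by all $\widetilde\Phi^{(n)}(f)$, and the eigenspaces of $L_0$ for the energies $1,\dots,n$ are null, i.e. every eigenvector of $L_0$ with such an eigenvalue is a null vector (zero after null vectors are divided out). The commutation relations of the modes and the centrality of the modes with $|m|\le n$ hold moreover in every representation of the light-ray commutation relation above, that is, for every map $\widetilde\Phi^{(n)}$ from $C^\infty(S^1)$ to a unital associative complex algebra which satisfies it. -/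

import Mathlib

/-!
The conformally extended `n`-th derivative `Φ^(n) = ∂^n j` of the chiral `U(1)` current, built in
its vacuum representation from the vacuum two-point function of the current on the light-ray.
-/

open scoped ContDiff

noncomputable section

namespace DerivativeField

/-! ### Test functions on the circle and their images on the light-ray -/

/-- The space `C^∞(S¹)` of smooth complex test functions on the circle: functions `f` such that
`θ ↦ f (exp (i θ))` is smooth. -/
def CircleTest : Submodule ℂ (Circle → ℂ) where
  carrier := {f | ContDiff ℝ ∞ fun θ : ℝ => f (Circle.exp θ)}
  add_mem' {f g} hf hg := by
    rw [Set.mem_ofPred_eq] at hf hg ⊢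
    exact hf.add hg
  zero_mem' := by
    rw [Set.mem_ofPred_eq]
    exact contDiff_const
  smul_mem' c f hf := by
    rw [Set.mem_ofPred_eq] at hf ⊢
    exact hf.const_smul c

/-- The compactification of the light-ray, `x ↦ z = (1 + i x) / (1 - i x) = exp (2 i arctan x)`. -/
def cayley (x : ℝ) : Circle := Circle.exp (2 * Real.arctan x)

/-- The map `cayley` is the Cayley transform. -/
theorem coe_cayley (x : ℝ) :
    (cayley x : ℂ) = (1 + Complex.I * x) / (1 - Complex.I * x) := by
  have h1 : (1 - Complex.I * x : ℂ) ≠ 0 := by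
    intro h
    have := congrArg Complex.re h
    simp at this
  have h2 : ((Real.cos (Real.arctan x) : ℝ) : ℂ) ≠ 0 :=
    Complex.ofReal_ne_zero.2 (Real.cos_arctan_pos x).ne'
  have ht : (x : ℂ) * (Real.cos (Real.arctan x) : ℝ) = (Real.sin (Real.arctan x) : ℝ) := by
    have := Real.tan_mul_cos (Real.cos_arctan_pos x).ne'
    rw [Real.tan_arctan] at this
    exact_mod_cast this
  have hs : ((Real.sin (Real.arctan x) : ℝ) : ℂ) ^ 2 + ((Real.cos (Real.arctan x) : ℝ) : ℂ) ^ 2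
      = 1 := by
    exact_mod_cast Real.sin_sq_add_cos_sq (Real.arctan x)
  have he : (cayley x : ℂ) = (((Real.cos (Real.arctan x) : ℝ) : ℂ)
      + ((Real.sin (Real.arctan x) : ℝ) : ℂ) * Complex.I) ^ 2 := by
    rw [cayley, Circle.coe_exp, Complex.ofReal_cos, Complex.ofReal_sin, ← Complex.exp_mul_I,
      ← Complex.exp_nat_mul]
    congr 1
    push_cast
    ring
  rw [he, eq_div_iff h1, ← ht]
  rw [← ht] at hs
  generalize ((Real.cos (Real.arctan x) : ℝ) : ℂ) = c at *
  linear_combination (1 + Complex.I * x) * hs +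
    (x ^ 3 * c ^ 2 * (-Complex.I) - c ^ 2 * x ^ 2) * Complex.I_sq

/-- The transformation `f ↦ f̂` from test functions on the circle to functions on the light-ray for
a field of scaling dimension `n + 1`.  With `z = exp (i θ)`, `x = tan (θ / 2)` and
`f (z) = z ^ n * h (θ)` it is `f̂ (x) = (dx/dθ) ^ n * h (θ)`; in terms of `z` it is
`2 ^ n * (1 + z) ^ (- 2 n) * f (z)`. -/
def hat (n : ℕ) (f : CircleTest) (x : ℝ) : ℂ :=
  (1 - Complex.I * x) ^ (2 * n) / 2 ^ n * (f : Circle → ℂ) (cayley x)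

/-- The test function `z ↦ z ^ (n + m)` on the circle. -/
def modeFunction (n : ℕ) (m : ℤ) : CircleTest :=
  ⟨fun z => (z : ℂ) ^ ((n : ℤ) + m), by
    have h : (fun θ : ℝ => ((Circle.exp θ : Circle) : ℂ) ^ ((n : ℤ) + m)) =
        fun θ : ℝ => Complex.exp ((((n : ℤ) + m : ℤ) : ℂ) * (θ * Complex.I)) := by
      funext θ
      rw [Circle.coe_exp, Complex.exp_int_mul]
    change ContDiff ℝ ∞ (fun θ : ℝ => ((Circle.exp θ : Circle) : ℂ) ^ ((n : ℤ) + m))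
    rw [h]
    exact (contDiff_const.mul (Complex.ofRealCLM.contDiff.mul contDiff_const)).cexp⟩

/-- The polynomial `Π^(n) (m) = ∏_{k=0}^{2n} (m - n + k)`. -/
def modePolynomial (n : ℕ) (m : ℤ) : ℤ := ∏ k ∈ Finset.range (2 * n + 1), (m - n + k)

/-- The light-ray commutation relation
`[Φ^(n)(x), Φ^(n)(y)] = (i / 2π) (-1)^n δ^(2n+1)(x - y)`, smeared with the images `f̂`, `ĝ` of test
functions on the circle, for a conformally extended field `Φ` with `Φ (f) = Φ^(n) (f̂)`. -/
def ObeysLightRayCCR (n : ℕ) {A : Type*} [Ring A] [Algebra ℂ A] (Φ : CircleTest → A) : Prop :=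
  ∀ f g : CircleTest, Φ f * Φ g - Φ g * Φ f =
    algebraMap ℂ A (Complex.I / (2 * Real.pi) * (-1) ^ n *
      ∫ x : ℝ, hat n f x * iteratedDeriv (2 * n + 1) (hat n g) x)

/-! ### The two-point function -/

/-- The momentum space wave function of the current vector `∂^n j (f̂) Ω = (-1)^n j (∂^n f̂) Ω`,
where `j (h) Ω` has the wave function `p ↦ ∫ h (x) exp (i p x) dx` on `p > 0`.  It is written by
means of `∂^(2n+1) f̂`, which is integrable, although `f̂` may grow like `x ^ (2n)`; the identity
`∫ ∂^(2n+1) f̂ (x) exp (i p x) dx = (-i p) ^ (n+1) ∫ ∂^n f̂ (x) exp (i p x) dx` holds for rapidly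
decreasing `f̂`. -/
def waveFunction (n : ℕ) (f : CircleTest) (p : ℝ) : ℂ :=
  (-1) ^ n * ((-(Complex.I * p)) ^ (n + 1))⁻¹ *
    ∫ x : ℝ, iteratedDeriv (2 * n + 1) (hat n f) x * Complex.exp (Complex.I * p * x)

/-- The vacuum expectation value `⟨Ω, Φ (f) Φ (g) Ω⟩`, from the two-point function
`⟨Ω, j (x) j (y) Ω⟩ = (1 / 4π²) ∫_0^∞ p exp (- i p (x - y)) dp` of the current. -/
def twoPoint (n : ℕ) (f g : CircleTest) : ℂ :=
  1 / (4 * (Real.pi : ℂ) ^ 2) *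
    ∫ p in Set.Ioi (0 : ℝ), (p : ℂ) * waveFunction n f (-p) * waveFunction n g p

/-! ### The Fock space and the field -/

/-- Finite particle vectors before null vectors are divided out: polynomials in commuting creation
operators `a*(f)`, one for each test function, applied to the vacuum `Ω = 1`. -/
abbrev PreFock : Type := MvPolynomial CircleTest ℂ

/-- The annihilation part of the field: the derivation `a (f)` with `a (f) a*(g) Ω = ⟨Ω, Φ (f) Φ (g)
Ω⟩ Ω`. -/
def annihilation (n : ℕ) (f : CircleTest) : PreFock →ₗ[ℂ] PreFock :=
  (MvPolynomial.mkDerivation ℂ fun g : CircleTest =>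
    (MvPolynomial.C (twoPoint n f g) : PreFock)).toLinearMap

/-- The field `a*(f) + a (f)` before null vectors are divided out. -/
def preField (n : ℕ) (f : CircleTest) : Module.End ℂ PreFock :=
  LinearMap.mulLeft ℂ (MvPolynomial.X f : PreFock) + annihilation n f

/-- The null vectors: those `v` with `⟨Ω, Φ (f₁) ⋯ Φ (f_k) v⟩ = 0` for all `k` and all test
functions, that is, the vectors orthogonal to all vectors `Φ (f₁) ⋯ Φ (f_k) Ω` (which span the
space); by positivity of the vacuum state these are the vectors of zero norm.  The inner product with `Ω = 1` is the constant coefficient. -/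
def nullSpace (n : ℕ) : Submodule ℂ PreFock where
  carrier := {v | ∀ l : List CircleTest,
    MvPolynomial.constantCoeff ((l.map (preField n)).prod v) = 0}
  add_mem' hu hv l := by rw [map_add, map_add, hu l, hv l, add_zero]
  zero_mem' l := by rw [map_zero, map_zero]
  smul_mem' c v hv l := by
    rw [map_smul, MvPolynomial.smul_eq_C_mul, map_mul, hv l, mul_zero]

theorem preField_mem_nullSpace (n : ℕ) (f : CircleTest) :
    nullSpace n ≤ (nullSpace n).comap (preField n f) := by
  intro v hv l
  have := hv (l ++ [f])
  simpa using this

/-- The Wightman domain of the field: the vacuum Fock space with null vectors divided out. -/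
abbrev WightmanDomain (n : ℕ) : Type := PreFock ⧸ nullSpace n

/-- The conformally extended `n`-th derivative field on the circle, smeared with `f`. -/
def field (n : ℕ) (f : CircleTest) : Module.End ℂ (WightmanDomain n) :=
  (nullSpace n).mapQ (nullSpace n) (preField n f) (preField_mem_nullSpace n f)

/-! ### The conformal Hamiltonian -/

/-- The action `f ↦ n f - z f'` of the conformal Hamiltonian on test functions, `z d/dz = - i d/dθ`.
It generates the rotations `h (θ) ↦ h (θ - t)`, where `f (exp (i θ)) = exp (i n θ) h (θ)`. -/
def testHamiltonian (n : ℕ) (f : CircleTest) : CircleTest :=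
  ⟨fun z => n * (f : Circle → ℂ) z +
      Complex.I * deriv (fun t : ℝ => (f : Circle → ℂ) (z * Circle.exp t)) 0, by
    have hf : ContDiff ℝ ∞ fun θ : ℝ => (f : Circle → ℂ) (Circle.exp θ) := f.2
    have h : (fun θ : ℝ => deriv (fun t : ℝ => (f : Circle → ℂ)
        (Circle.exp θ * Circle.exp t)) 0) =
        deriv fun θ : ℝ => (f : Circle → ℂ) (Circle.exp θ) := by
      funext θ
      have := deriv_comp_const_add (f := fun s : ℝ => (f : Circle → ℂ) (Circle.exp s)) θ 0
      simpa [Circle.exp_add] using this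
    have hd : ContDiff ℝ ∞ (deriv fun θ : ℝ => (f : Circle → ℂ) (Circle.exp θ)) :=
      (contDiff_infty_iff_deriv.1 hf).2
    rw [← h] at hd
    exact (contDiff_const.mul hf).add (contDiff_const.mul hd)⟩

/-- The conformal Hamiltonian `L_0` before null vectors are divided out: `L_0 Ω = 0` and
`[L_0, a*(f)] = a*(n f - z f')`. -/
def preHamiltonian (n : ℕ) : Module.End ℂ PreFock :=
  (MvPolynomial.mkDerivation ℂ fun f : CircleTest =>
    (MvPolynomial.X (testHamiltonian n f) : PreFock)).toLinearMap

/-- The eigenspace of `L_0` for the energy `E` in the Wightman domain: the classes of those `v` for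
which `L_0 v - E v` is a null vector. -/
def energyEigenspace (n : ℕ) (E : ℂ) : Submodule ℂ (WightmanDomain n) :=
  ((nullSpace n).comap (preHamiltonian n - algebraMap ℂ (Module.End ℂ PreFock) E)).map
    (nullSpace n).mkQ

end DerivativeField

end

/-!
Everything reduces to the Fourier coefficients `c_s (f)` of the test functions, `f = ∑ c_s z ^ s`.

The commutator contains `∂^(2n+1) f̂`. Since `f̂` is a density of weight `- n`, Bol's lemma
(`iteratedDeriv_density`) says that this derivative is a density of weight `n + 1` into which `f`
enters only through `B f`, where `B` is the product of the conformal Hamiltonians `f ↦ j f - z f'`,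
`0 ≤ j ≤ 2 n`. It multiplies `c_s` by `∏_j (j - s)`. The substitution `x = tan (θ / 2)` turns the
light-ray commutator of `f` and `g` into the Fourier coefficient of `f B g` at `z ^ (2 n)`
(`commutator_eq_circleCoeff`). For `f = z ^ (n + m)` this is `Π^(n) (m) c_(n-m) (g)`, which gives the
commutation relations of the modes and, `Π^(n)` being zero at `|m| ≤ n`, centrality, in every
representation.

In the two-point function the Fourier transforms of the modes of `∂^(2n+1) f̂` are the Laguerre
functions `p ^ (2n+1) exp (- p) L_r^(2n+1) (2 p)` for positive momentum or vanish there. Their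
orthogonality gives `⟨Ω, Φ (f) Φ (g) Ω⟩ = ∑_r (r + 2n + 1)! / r! c_(r+2n+1) (f) c_(-1-r) (g)`
(`hasSum_twoPoint`). The antisymmetric part is the light-ray commutator, so the field on the Fock
space satisfies the commutation relation; the two-point function is rotation invariant; and the modes
`z ^ (n + m)` with `m ≤ n` have no annihilation part.

Let `v` have the energy `k`, `1 ≤ k ≤ n`, up to null vectors. By rotation invariance
`⟨Ω, Φ_(m₁) ⋯ Φ_(m_l) v⟩` vanishes unless `∑ m_i = k`. If some `m_i ≤ n`, that mode may be moved to
the left, where it annihilates the vacuum; the commutators are numbers, so only shorter correlations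
remain. If all `m_i > n`, then `∑ m_i` exceeds `n` or the product is empty, and is not `k`. So all
correlations of `v` with modes vanish (`correlation_modes_eq_zero`), hence, by Fourier expansion in
one test function after the other, all its correlations, and `v` is null.
-/

noncomputable section

namespace DerivativeField

open MeasureTheory

/-! ### Fourier series of test functions on the circle -/

theorem contDiff_lift (f : CircleTest) :
    ContDiff ℝ ∞ fun θ : ℝ => (f : Circle → ℂ) (Circle.exp θ) := f.2

theorem continuous_circleTest (f : CircleTest) : Continuous (f : Circle → ℂ) := by
  have h : Continuous fun x : AddCircle (2 * Real.pi) =>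
      (f : Circle → ℂ) (AddCircle.homeomorphCircle' x) :=
    continuous_coinduced_dom.mpr (contDiff_lift f).continuous
  have h2 := h.comp AddCircle.homeomorphCircle'.symm.continuous
  simpa only [Function.comp_def, Homeomorph.apply_symm_apply] using h2

theorem exists_bound_circleTest (f : CircleTest) :
    ∃ M : ℝ, ∀ z, ‖(f : Circle → ℂ) z‖ ≤ M := by
  obtain ⟨M, hM⟩ := isCompact_univ.exists_bound_of_continuousOn
    (continuous_circleTest f).continuousOn
  exact ⟨M, fun z => hM z trivial⟩

/-- Differentiation along the circle, expressed by the action of the conformal Hamiltonian. -/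
theorem hasDerivAt_lift (a : ℕ) (f : CircleTest) (θ : ℝ) :
    HasDerivAt (fun θ : ℝ => (f : Circle → ℂ) (Circle.exp θ))
      (Complex.I * (a * (f : Circle → ℂ) (Circle.exp θ) -
        (testHamiltonian a f : Circle → ℂ) (Circle.exp θ))) θ := by
  have h1 : HasDerivAt (fun θ : ℝ => (f : Circle → ℂ) (Circle.exp θ))
      (deriv (fun θ : ℝ => (f : Circle → ℂ) (Circle.exp θ)) θ) θ :=
    ((contDiff_lift f).differentiable (by simp) θ).hasDerivAt
  convert h1 using 1
  have h2 := deriv_comp_const_add (f := fun s : ℝ => (f : Circle → ℂ) (Circle.exp s)) θ 0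
  simp only [Circle.exp_add, add_zero] at h2
  change Complex.I * (_ - (_ + Complex.I * deriv (fun t : ℝ => (f : Circle → ℂ)
    (Circle.exp θ * Circle.exp t)) 0)) = _
  rw [h2]
  linear_combination (-deriv (fun θ : ℝ => (f : Circle → ℂ) (Circle.exp θ)) θ) * Complex.I_sq

/-- The pointwise product of two test functions. -/
def circleMul (f g : CircleTest) : CircleTest :=
  ⟨fun z => (f : Circle → ℂ) z * (g : Circle → ℂ) z, (contDiff_lift f).mul (contDiff_lift g)⟩

/-- The Fourier coefficient of `f` at `z ^ s`, for `s : ℤ`. -/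
def circleCoeff (s : ℤ) (f : CircleTest) : ℂ :=
  (2 * Real.pi : ℂ)⁻¹ * ∫ θ in (-Real.pi)..Real.pi,
    Complex.exp (-(s * θ * Complex.I)) * (f : Circle → ℂ) (Circle.exp θ)

theorem intervalIntegrable_circleCoeff (s : ℤ) (f : CircleTest) (a b : ℝ) :
    IntervalIntegrable (fun θ : ℝ => Complex.exp (-(s * θ * Complex.I)) *
      (f : Circle → ℂ) (Circle.exp θ)) volume a b := by
  apply Continuous.intervalIntegrable
  have h1 : Continuous fun θ : ℝ => Complex.exp (-(s * θ * Complex.I)) := by fun_prop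
  exact h1.mul (contDiff_lift f).continuous

theorem circleCoeff_smul (s : ℤ) (c : ℂ) (f : CircleTest) :
    circleCoeff s (c • f) = c * circleCoeff s f := by
  rw [circleCoeff, circleCoeff, mul_left_comm, ← intervalIntegral.integral_const_mul c]
  congr 2
  funext θ
  exact mul_left_comm _ _ _

theorem circleCoeff_testHamiltonian (a : ℕ) (s : ℤ) (f : CircleTest) :
    circleCoeff s (testHamiltonian a f) = (a - s) * circleCoeff s f := by
  have hd (θ : ℝ) : HasDerivAt (fun θ : ℝ => Complex.exp (-(s * θ * Complex.I)) *
      (f : Circle → ℂ) (Circle.exp θ))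
      (Complex.I * ((a - s) * (Complex.exp (-(s * θ * Complex.I)) *
          (f : Circle → ℂ) (Circle.exp θ)) -
        Complex.exp (-(s * θ * Complex.I)) *
          (testHamiltonian a f : Circle → ℂ) (Circle.exp θ))) θ := by
    have h1 : HasDerivAt (fun θ : ℝ => Complex.exp (-(s * θ * Complex.I)))
        (Complex.exp (-(s * θ * Complex.I)) * (-(s * 1 * Complex.I))) θ :=
      (((Complex.ofRealCLM.hasDerivAt (x := θ)).const_mul (s : ℂ)).mul_const Complex.I).neg.cexp
    convert! h1.mul (hasDerivAt_lift a f θ) using 1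
    ring
  have hI := intervalIntegrable_circleCoeff s f (-Real.pi) Real.pi
  have hH := intervalIntegrable_circleCoeff s (testHamiltonian a f) (-Real.pi) Real.pi
  have h0 := intervalIntegral.integral_eq_sub_of_hasDerivAt (fun θ _ => hd θ)
    (((hI.const_mul _).sub hH).const_mul _)
  -- There is no boundary term, the integrand being a derivative of a periodic function.
  have he : Circle.exp (-Real.pi) = Circle.exp Real.pi := by
    ext; simp [Circle.coe_exp]
  have hs : Complex.exp (-(s * (-Real.pi : ℝ) * Complex.I)) =
      Complex.exp (-(s * (Real.pi : ℝ) * Complex.I)) := by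
    rw [Complex.exp_eq_exp_iff_exists_int]
    exact ⟨s, by push_cast; ring⟩
  rw [he, hs, sub_self, intervalIntegral.integral_const_mul,
    intervalIntegral.integral_sub (hI.const_mul _) hH, intervalIntegral.integral_const_mul] at h0
  have h1 := (mul_eq_zero.1 h0).resolve_left Complex.I_ne_zero
  rw [circleCoeff, circleCoeff]
  linear_combination (-(2 * Real.pi : ℂ)⁻¹) * h1

theorem circleCoeff_eq_fourierCoeff (s : ℤ) (f : CircleTest) :
    haveI : Fact (0 < 2 * Real.pi) := ⟨Real.two_pi_pos⟩
    circleCoeff s f = fourierCoeff (fun x : AddCircle (2 * Real.pi) =>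
      (f : Circle → ℂ) (AddCircle.homeomorphCircle' x)) s := by
  have : Fact (0 < 2 * Real.pi) := ⟨Real.two_pi_pos⟩
  have hpi : (Real.pi : ℂ) ≠ 0 := Complex.ofReal_ne_zero.2 Real.pi_ne_zero
  have e : -Real.pi + 2 * Real.pi = Real.pi := by ring
  rw [fourierCoeff_eq_intervalIntegral _ _ (-Real.pi), e, circleCoeff, Complex.real_smul]
  push_cast
  rw [one_div]
  congr 1
  refine intervalIntegral.integral_congr fun θ _ => ?_
  simp only [fourier_coe_apply, smul_eq_mul, AddCircle.homeomorphCircle'_apply_mk]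
  congr 2
  push_cast
  field_simp

theorem summable_norm_circleCoeff (f : CircleTest) :
    Summable fun s : ℤ => ‖circleCoeff s f‖ := by
  -- Applying `f ↦ - z f'` twice multiplies `c_s` by `s ^ 2` and leaves it bounded.
  obtain ⟨M, hM⟩ :=
    exists_bound_circleTest (testHamiltonian 0 (testHamiltonian 0 f))
  have hb (s : ℤ) : ‖circleCoeff s (testHamiltonian 0 (testHamiltonian 0 f))‖ ≤ M := by
    have h1 := intervalIntegral.norm_integral_le_of_norm_le_const (a := -Real.pi) (b := Real.pi)
      (f := fun θ : ℝ => Complex.exp (-(s * θ * Complex.I)) *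
        (testHamiltonian 0 (testHamiltonian 0 f) : Circle → ℂ) (Circle.exp θ)) (C := M)
      fun θ _ => by
        have : Complex.exp (-(s * θ * Complex.I)) =
          Complex.exp ((-(s * θ) : ℝ) * Complex.I) := by push_cast; ring_nf
        rw [norm_mul, this, Complex.norm_exp_ofReal_mul_I, one_mul]
        exact hM _
    rw [circleCoeff, norm_mul]
    have h2 : ‖(2 * Real.pi : ℂ)⁻¹‖ = (2 * Real.pi)⁻¹ := by
      rw [norm_inv, norm_mul, Complex.norm_real, Complex.norm_two,
        Real.norm_of_nonneg Real.pi_pos.le]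
    have h3 : |Real.pi - -Real.pi| = 2 * Real.pi := by
      rw [abs_of_pos] <;> linarith [Real.pi_pos]
    rw [h2, inv_mul_le_iff₀ Real.two_pi_pos, mul_comm]
    rwa [h3] at h1
  have hs : Summable fun s : ℤ => M * (1 / (s : ℝ) ^ 2) :=
    (Real.summable_one_div_int_pow.2 one_lt_two).mul_left M
  refine hs.of_norm_bounded_eventually ?_
  have : ∀ᶠ s : ℤ in Filter.cofinite, s ≠ 0 :=
    (Set.finite_singleton (0 : ℤ)).compl_mem_cofinite
  filter_upwards [this] with s hs
  have hs' : (0 : ℝ) < (s : ℝ) ^ 2 := by positivity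
  rw [norm_norm, mul_one_div, le_div_iff₀ hs']
  refine le_trans (le_of_eq ?_) (hb s)
  rw [circleCoeff_testHamiltonian, circleCoeff_testHamiltonian, norm_mul, norm_mul]
  have : ‖((0 : ℕ) - s : ℂ)‖ = |(s : ℝ)| := by simp
  rw [this, ← sq_abs]
  ring

/-- A test function is the sum of its Fourier series. -/
theorem hasSum_circleCoeff (f : CircleTest) (z : Circle) :
    HasSum (fun s : ℤ => circleCoeff s f * (z : ℂ) ^ s) ((f : Circle → ℂ) z) := by
  have : Fact (0 < 2 * Real.pi) := ⟨Real.two_pi_pos⟩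
  let F : C(AddCircle (2 * Real.pi), ℂ) :=
    ⟨fun x => (f : Circle → ℂ) (AddCircle.homeomorphCircle' x),
      (continuous_circleTest f).comp AddCircle.homeomorphCircle'.continuous⟩
  have hF (s : ℤ) : fourierCoeff F s = circleCoeff s f := (circleCoeff_eq_fourierCoeff s f).symm
  have hsum : Summable (fourierCoeff F) := by
    rw [funext hF]
    exact (summable_norm_circleCoeff f).of_norm
  obtain ⟨θ, rfl⟩ : ∃ θ : ℝ, Circle.exp θ = z := ⟨_, Circle.exp_arg z⟩
  have := has_pointwise_sum_fourier_series_of_summable hsum (θ : AddCircle (2 * Real.pi))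
  have hpi : (Real.pi : ℂ) ≠ 0 := Complex.ofReal_ne_zero.2 Real.pi_ne_zero
  convert! this using 2 with s
  rw [hF, smul_eq_mul, fourier_coe_apply, Circle.coe_exp, ← Complex.exp_int_mul]
  congr 2
  push_cast
  field_simp

/-- Integration against an integrable density on any measure space mapped to the circle may be
carried out term by term in the Fourier series. -/
theorem hasSum_integral_circleCoeff {α : Type*} [MeasurableSpace α] {μ : Measure α}
    {φ : α → ℂ} (hφ : Integrable φ μ) {τ : α → ℝ} (hτ : Measurable τ) (f : CircleTest) :
    HasSum (fun s : ℤ => circleCoeff s f * ∫ x, φ x * (Circle.exp (τ x) : ℂ) ^ s ∂μ)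
      (∫ x, φ x * (f : Circle → ℂ) (Circle.exp (τ x)) ∂μ) := by
  have hn (s : ℤ) (x : α) : ‖(Circle.exp (τ x) : ℂ) ^ s‖ = 1 := by
    rw [norm_zpow, Circle.norm_coe, one_zpow]
  have hm (s : ℤ) : AEStronglyMeasurable (fun x => (Circle.exp (τ x) : ℂ) ^ s) μ := by
    have h1 : Continuous fun θ : ℝ => (Circle.exp θ : ℂ) ^ s :=
      (continuous_subtype_val.comp Circle.exp.continuous).zpow₀ s fun z =>
        Or.inl (Circle.coe_ne_zero _)
    exact (h1.measurable.comp hτ).aestronglyMeasurable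
  have hi (s : ℤ) : Integrable (fun x => φ x * (Circle.exp (τ x) : ℂ) ^ s) μ :=
    hφ.mul_bdd (hm s) (Filter.Eventually.of_forall fun x => (hn s x).le)
  have := hasSum_integral_of_summable_integral_norm
    (F := fun (s : ℤ) x => circleCoeff s f * (φ x * (Circle.exp (τ x) : ℂ) ^ s)) (μ := μ)
    (fun s => (hi s).const_mul _) (by
      simp only [norm_mul, hn, mul_one, integral_const_mul]
      exact (summable_norm_circleCoeff f).mul_right _)
  simp only [integral_const_mul] at this
  convert! this using 1
  refine integral_congr_ae (Filter.Eventually.of_forall fun x => ?_)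
  have h := (hasSum_circleCoeff f (Circle.exp (τ x))).mul_left (φ x)
  simp only [mul_left_comm (φ x)] at h
  exact h.tsum_eq.symm

theorem circleCoeff_modeFunction (n : ℕ) (m s : ℤ) :
    circleCoeff s (modeFunction n m) = if s = n + m then 1 else 0 := by
  have : Fact (0 < 2 * Real.pi) := ⟨Real.two_pi_pos⟩
  have hpi : (Real.pi : ℂ) ≠ 0 := Complex.ofReal_ne_zero.2 Real.pi_ne_zero
  have h : (fun x : AddCircle (2 * Real.pi) => (modeFunction n m : Circle → ℂ)
      (AddCircle.homeomorphCircle' x)) = fourier ((n : ℤ) + m) := by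
    funext x
    induction x using QuotientAddGroup.induction_on with | H θ => ?_
    change ((Circle.exp θ : Circle) : ℂ) ^ ((n : ℤ) + m) = _
    rw [fourier_coe_apply, Circle.coe_exp, ← Complex.exp_int_mul]
    congr 1
    push_cast
    field_simp
  rw [circleCoeff_eq_fourierCoeff, h, fourierCoeff_fourier]
  simp [Pi.single_apply]

/-- The Fourier coefficients of a product are the convolution of those of the factors. -/
theorem hasSum_circleCoeff_mul (t : ℤ) (f g : CircleTest) :
    HasSum (fun s : ℤ => circleCoeff s g * circleCoeff (t - s) f) (circleCoeff t (circleMul f g)) := by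
  have hpi : -Real.pi ≤ Real.pi := by linarith [Real.pi_pos]
  have h := hasSum_integral_circleCoeff
    (intervalIntegrable_circleCoeff t f (-Real.pi) Real.pi).1
    measurable_id g
  convert! h.mul_left (2 * Real.pi : ℂ)⁻¹ using 1
  · funext s
    rw [mul_left_comm]
    congr 1
    rw [circleCoeff, intervalIntegral.integral_of_le hpi]
    congr 2
    funext θ
    rw [id, Circle.coe_exp, ← Complex.exp_int_mul, mul_right_comm (Complex.exp _), ← Complex.exp_add]
    congr 2
    push_cast
    ring
  · rw [circleCoeff, intervalIntegral.integral_of_le hpi]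
    simp only [circleMul, mul_assoc, id]

theorem circleCoeff_modeFunction_mul (n : ℕ) (m t : ℤ) (g : CircleTest) :
    circleCoeff t (circleMul (modeFunction n m) g) = circleCoeff (t - n - m) g := by
  refine (hasSum_circleCoeff_mul t (modeFunction n m) g).unique ?_
  convert! hasSum_ite_eq (t - n - m) (circleCoeff (t - n - m) g) using 2 with s
  rw [circleCoeff_modeFunction]
  by_cases h : s = t - n - m
  · subst h
    rw [if_pos (by ring), if_pos rfl, mul_one]
  · rw [if_neg (by intro h'; apply h; omega), if_neg h, mul_zero]

/-! ### Derivatives of order `2 n + 1` on the light-ray -/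

theorem one_sub_I_mul_ne_zero (x : ℝ) : (1 - Complex.I * x : ℂ) ≠ 0 := by
  intro h
  simpa using congrArg Complex.re h

theorem one_add_I_mul_ne_zero (x : ℝ) : (1 + Complex.I * x : ℂ) ≠ 0 := by
  intro h
  simpa using congrArg Complex.re h

theorem one_sub_I_mul_mul_one_add (x : ℝ) :
    (1 - Complex.I * x : ℂ) * (1 + Complex.I * x) = ((1 + x ^ 2 : ℝ) : ℂ) := by
  push_cast
  linear_combination (-(x : ℂ) ^ 2) * Complex.I_sq

theorem contDiff_comp_cayley (f : CircleTest) :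
    ContDiff ℝ ∞ fun x : ℝ => (f : Circle → ℂ) (cayley x) :=
  (contDiff_lift f).comp (contDiff_const.mul Real.contDiff_arctan)

theorem hasDerivAt_comp_cayley (a : ℕ) (f : CircleTest) (x : ℝ) :
    HasDerivAt (fun x : ℝ => (f : Circle → ℂ) (cayley x))
      (2 * Complex.I * (1 - Complex.I * x)⁻¹ * (1 + Complex.I * x)⁻¹ *
        (a * (f : Circle → ℂ) (cayley x) - (testHamiltonian a f : Circle → ℂ) (cayley x))) x := by
  have h1 := (hasDerivAt_lift a f (2 * Real.arctan x)).scomp x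
    ((Real.hasDerivAt_arctan x).const_mul 2)
  convert! h1 using 1
  have h2 : (1 - Complex.I * x : ℂ)⁻¹ * (1 + Complex.I * x)⁻¹ = ((1 + x ^ 2 : ℝ) : ℂ)⁻¹ := by
    rw [← mul_inv, one_sub_I_mul_mul_one_add]
  rw [Complex.real_smul, mul_assoc (2 * Complex.I), h2, cayley]
  push_cast
  ring

/-- The product of the conformal Hamiltonians `f ↦ j f - z f'` for the scaling dimensions `j + 1`
with `j < a`, which is `(-1) ^ a z ^ a (d/dz) ^ a`. -/
def bolOperator : ℕ → CircleTest → CircleTest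
  | 0, f => f
  | a + 1, f => testHamiltonian a (bolOperator a f)

theorem circleCoeff_bolOperator (a : ℕ) (s : ℤ) (f : CircleTest) :
    circleCoeff s (bolOperator a f) = (∏ j ∈ Finset.range a, ((j : ℂ) - s)) * circleCoeff s f := by
  induction a with
  | zero => simp [bolOperator]
  | succ a ih => rw [bolOperator, circleCoeff_testHamiltonian, ih, Finset.prod_range_succ]; ring

theorem hasDerivAt_one_sub_I_mul (x : ℝ) :
    HasDerivAt (fun x : ℝ => (1 - Complex.I * x : ℂ)) (-Complex.I) x := by
  have := ((Complex.ofRealCLM.hasDerivAt (x := x)).const_mul Complex.I).const_sub 1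
  simpa using this

theorem hasDerivAt_one_add_I_mul (x : ℝ) :
    HasDerivAt (fun x : ℝ => (1 + Complex.I * x : ℂ)) Complex.I x := by
  have := ((Complex.ofRealCLM.hasDerivAt (x := x)).const_mul Complex.I).const_add 1
  simpa using this

theorem contDiff_one_sub_I_mul : ContDiff ℝ ∞ fun x : ℝ => (1 - Complex.I * x : ℂ) :=
  contDiff_const.sub (contDiff_const.mul Complex.ofRealCLM.contDiff)

theorem iteratedDeriv_one_sub_I_mul_mul (k : ℕ) {g : ℝ → ℂ} (hg : ContDiff ℝ ∞ g) :
    iteratedDeriv (k + 1) (fun x : ℝ => (1 - Complex.I * x) * g x) = fun x =>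
      (1 - Complex.I * x) * iteratedDeriv (k + 1) g x - Complex.I * (k + 1) * iteratedDeriv k g x := by
  have hd (k : ℕ) (x : ℝ) : HasDerivAt (iteratedDeriv k g) (iteratedDeriv (k + 1) g x) x := by
    rw [iteratedDeriv_succ]
    exact (hg.differentiable_iteratedDeriv k (by exact_mod_cast WithTop.coe_lt_top _) x).hasDerivAt
  induction k with
  | zero =>
    funext x
    have := ((hasDerivAt_one_sub_I_mul x).mul (hd 0 x)).deriv
    simp only [iteratedDeriv_zero, zero_add] at this
    rw [iteratedDeriv_succ, iteratedDeriv_zero]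
    refine (Eq.trans ?_ this).trans ?_
    · rfl
    · simp [iteratedDeriv_zero]; ring
  | succ k ih =>
    funext x
    rw [iteratedDeriv_succ, ih]
    have := (((hasDerivAt_one_sub_I_mul x).mul (hd (k + 1) x)).sub
      ((hd k x).const_mul (Complex.I * (k + 1)))).deriv
    refine (Eq.trans ?_ this).trans ?_
    · rfl
    · push_cast; ring

/-- Bol's lemma: the `(a + 1)`-st derivative maps densities of weight `- a / 2` to densities of
weight `(a + 2) / 2`, hence only the top derivative of `f` enters. -/
theorem iteratedDeriv_density (a : ℕ) (f : CircleTest) :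
    iteratedDeriv (a + 1) (fun x : ℝ => (1 - Complex.I * x) ^ a * (f : Circle → ℂ) (cayley x)) =
      fun x : ℝ => (-2 * Complex.I) ^ (a + 1) * (1 - Complex.I * x)⁻¹ *
        ((1 + Complex.I * x)⁻¹) ^ (a + 1) * (bolOperator (a + 1) f : Circle → ℂ) (cayley x) := by
  induction a with
  | zero =>
    funext x
    simp only [pow_zero, one_mul, zero_add, pow_one, bolOperator, iteratedDeriv_one]
    rw [(hasDerivAt_comp_cayley 0 f x).deriv]
    push_cast
    ring
  | succ a ih =>
    funext x
    have hs : ContDiff ℝ ∞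
        fun x : ℝ => (1 - Complex.I * x) ^ a * (f : Circle → ℂ) (cayley x) :=
      (contDiff_one_sub_I_mul.pow a).mul (contDiff_comp_cayley f)
    -- Leibniz' rule for one factor `1 - i x` needs only the derivatives of orders `a + 1`, `a + 2`
    -- of the remaining density, both of which the induction hypothesis provides.
    have h1 : (fun x : ℝ => (1 - Complex.I * x) ^ (a + 1) * (f : Circle → ℂ) (cayley x)) =
        fun x : ℝ => (1 - Complex.I * x) *
          ((1 - Complex.I * x) ^ a * (f : Circle → ℂ) (cayley x)) := by
      funext x; ring
    rw [h1, iteratedDeriv_one_sub_I_mul_mul (a + 1) hs, iteratedDeriv_succ, ih]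
    have hne := one_sub_I_mul_ne_zero x
    have hpe := one_add_I_mul_ne_zero x
    have hd := ((((hasDerivAt_one_sub_I_mul x).inv hne).const_mul
      ((-2 * Complex.I) ^ (a + 1))).mul (((hasDerivAt_one_add_I_mul x).inv hpe).pow (a + 1))).mul
      (hasDerivAt_comp_cayley (a + 1) (bolOperator (a + 1) f) x)
    refine (congrArg (fun d => (1 - Complex.I * (x : ℂ)) * d - _) hd.deriv).trans ?_
    simp only [Pi.mul_apply, Pi.pow_apply, Pi.inv_apply, bolOperator]
    generalize (testHamiltonian (a + 1) (testHamiltonian a (bolOperator a f)) : Circle → ℂ)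
      (cayley x) = u
    generalize (testHamiltonian a (bolOperator a f) : Circle → ℂ) (cayley x) = v
    have hds := mul_inv_cancel₀ hne
    have hpq := mul_inv_cancel₀ hpe
    rw [div_eq_mul_inv _ ((1 - Complex.I * (x : ℂ)) ^ 2),
      div_eq_mul_inv _ ((1 + Complex.I * (x : ℂ)) ^ 2), ← inv_pow, ← inv_pow]
    generalize (1 - Complex.I * (x : ℂ))⁻¹ = s at hds ⊢
    generalize (1 + Complex.I * (x : ℂ))⁻¹ = q at hpq ⊢
    push_cast
    simp only [pow_succ (-2 * Complex.I)]
    generalize (-2 * Complex.I) ^ a = c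
    linear_combination (c * (-2 * Complex.I) * Complex.I * s * q ^ (a + 1) * v *
      (1 + 2 * q * (a + 1)) - 2 * Complex.I * (c * (-2 * Complex.I)) * q ^ (a + 2) * s * u) * hds +
      c * (-2 * Complex.I) * Complex.I * s * q ^ (a + 1) * v * (a + 1) * hpq

/-- The derivative of order `2 n + 1` of `f̂`. -/
theorem iteratedDeriv_hat (n : ℕ) (f : CircleTest) (x : ℝ) :
    iteratedDeriv (2 * n + 1) (hat n f) x =
      (-2 * Complex.I) ^ (2 * n + 1) / 2 ^ n * ((1 - Complex.I * x)⁻¹ *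
        ((1 + Complex.I * x)⁻¹) ^ (2 * n + 1) *
          (bolOperator (2 * n + 1) f : Circle → ℂ) (cayley x)) := by
  have h : hat n f = fun x : ℝ => ((2 : ℂ) ^ n)⁻¹ * ((1 - Complex.I * x) ^ (2 * n) *
      (f : Circle → ℂ) (cayley x)) := by
    funext x; rw [hat]; ring
  rw [h, iteratedDeriv_const_mul_field, iteratedDeriv_density]
  ring

/-- The substitution `x = tan (θ / 2)`. -/
theorem integral_comp_cayley (f : CircleTest) :
    ∫ x : ℝ, (1 - Complex.I * x)⁻¹ * (1 + Complex.I * x)⁻¹ * (f : Circle → ℂ) (cayley x) =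
      Real.pi * circleCoeff 0 f := by
  have h1 : ∀ x ∈ Set.univ, HasDerivWithinAt (fun x => 2 * Real.arctan x)
      (2 * (1 / (1 + x ^ 2))) Set.univ x := fun x _ =>
    ((Real.hasDerivAt_arctan x).const_mul 2).hasDerivWithinAt
  have hinj : Set.InjOn (fun x => 2 * Real.arctan x) Set.univ := fun x _ y _ h =>
    Real.arctan_injective (mul_left_cancel₀ two_ne_zero h)
  have h2 := integral_image_eq_integral_abs_deriv_smul MeasurableSet.univ h1 hinj
    fun θ => (f : Circle → ℂ) (Circle.exp θ)
  have h3 : (fun x => 2 * Real.arctan x) '' Set.univ = Set.Ioo (-Real.pi) Real.pi := by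
    rw [Set.image_univ]
    ext θ
    constructor
    · rintro ⟨x, rfl⟩
      have := Real.neg_pi_div_two_lt_arctan x
      have := Real.arctan_lt_pi_div_two x
      constructor <;> simp only [] <;> linarith
    · rintro ⟨h, h'⟩
      refine ⟨Real.tan (θ / 2), ?_⟩
      simp only []
      rw [Real.arctan_tan (by linarith) (by linarith)]
      ring
  rw [h3, setIntegral_univ, ← integral_Ioc_eq_integral_Ioo,
    ← intervalIntegral.integral_of_le (by linarith [Real.pi_pos])] at h2
  have hpi : (Real.pi : ℂ) ≠ 0 := Complex.ofReal_ne_zero.2 Real.pi_ne_zero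
  have h4 : (∫ θ in (-Real.pi)..Real.pi, (f : Circle → ℂ) (Circle.exp θ)) =
      2 * Real.pi * circleCoeff 0 f := by
    rw [circleCoeff]
    field_simp
    simp
  have h5 : (∫ x : ℝ, |2 * (1 / (1 + x ^ 2))| • (f : Circle → ℂ) (Circle.exp (2 * Real.arctan x)))
      = 2 * ∫ x : ℝ, (1 - Complex.I * x)⁻¹ * (1 + Complex.I * x)⁻¹ *
        (f : Circle → ℂ) (cayley x) := by
    rw [← integral_const_mul]
    congr 1
    funext x
    rw [abs_of_pos (by positivity), Complex.real_smul, ← mul_inv, one_sub_I_mul_mul_one_add, cayley]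
    push_cast
    ring
  rw [h4, h5] at h2
  linear_combination (-(1 : ℂ) / 2) * h2

theorem neg_two_mul_I_pow (n : ℕ) :
    (-2 * Complex.I) ^ (2 * n + 1) = -2 * Complex.I * ((-1) ^ n * 4 ^ n) := by
  rw [pow_succ, pow_mul, mul_pow, Complex.I_sq, ← mul_pow]
  norm_num
  ring

/-- The commutator function in terms of Fourier coefficients. -/
theorem commutator_eq_circleCoeff (n : ℕ) (f g : CircleTest) :
    Complex.I / (2 * Real.pi) * (-1) ^ n *
      ∫ x : ℝ, hat n f x * iteratedDeriv (2 * n + 1) (hat n g) x =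
      circleCoeff (2 * n) (circleMul f (bolOperator (2 * n + 1) g)) := by
  have hpi : (Real.pi : ℂ) ≠ 0 := Complex.ofReal_ne_zero.2 Real.pi_ne_zero
  set h := circleMul f (bolOperator (2 * n + 1) g)
  -- The factors `1 ∓ i x` combine to `z ^ (- 2 n)` times the Jacobian `1 / (1 + x ^ 2)`.
  have h1 : circleCoeff 0 (circleMul (modeFunction n (-3 * n)) h) = circleCoeff (2 * n) h := by
    rw [circleCoeff_modeFunction_mul]
    congr 1
    ring
  have h2 (x : ℝ) : hat n f x * iteratedDeriv (2 * n + 1) (hat n g) x =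
      (-2 * Complex.I) ^ (2 * n + 1) / 4 ^ n * ((1 - Complex.I * x)⁻¹ * (1 + Complex.I * x)⁻¹ *
        (circleMul (modeFunction n (-3 * n)) h : Circle → ℂ) (cayley x)) := by
    have e : (circleMul (modeFunction n (-3 * n)) h : Circle → ℂ) (cayley x) =
      (cayley x : ℂ) ^ ((n : ℤ) + -3 * n) * ((f : Circle → ℂ) (cayley x) *
        (bolOperator (2 * n + 1) g : Circle → ℂ) (cayley x)) := rfl
    have e2 : (n : ℤ) + -3 * n = -((2 * n : ℕ) : ℤ) := by push_cast; ring
    have hne := one_sub_I_mul_ne_zero x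
    have hpe := one_add_I_mul_ne_zero x
    rw [iteratedDeriv_hat, e, e2, zpow_neg, zpow_natCast, coe_cayley, hat, div_pow, inv_div, inv_pow,
      show (4 : ℂ) ^ n = 2 ^ n * 2 ^ n by rw [← mul_pow]; norm_num]
    field_simp
    ring
  simp_rw [h2]
  rw [integral_const_mul, integral_comp_cayley, h1]
  have e4 : ((-1 : ℂ) ^ n) * (-1) ^ n = 1 := by rw [← mul_pow]; norm_num
  rw [neg_two_mul_I_pow]
  field_simp
  linear_combination (-Complex.I ^ 2 * circleCoeff (2 * n) h) * e4 -
    circleCoeff (2 * n) h * Complex.I_sq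

/-- The light-ray commutator of a mode with an arbitrary field. -/
theorem commutator_modeFunction (n : ℕ) (m : ℤ) (g : CircleTest) :
    Complex.I / (2 * Real.pi) * (-1) ^ n *
      ∫ x : ℝ, hat n (modeFunction n m) x * iteratedDeriv (2 * n + 1) (hat n g) x =
      (modePolynomial n m : ℂ) * circleCoeff (n - m) g := by
  rw [commutator_eq_circleCoeff, circleCoeff_modeFunction_mul, circleCoeff_bolOperator,
    show (2 * n - n - m : ℤ) = n - m by ring, modePolynomial]
  congr 1
  push_cast
  exact Finset.prod_congr rfl fun j _ => by ring

theorem modePolynomial_eq_zero {n : ℕ} {m : ℤ} (hm : |m| ≤ n) : modePolynomial n m = 0 := by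
  rw [abs_le] at hm
  refine Finset.prod_eq_zero (i := (n - m).toNat) (Finset.mem_range.2 (by omega)) (by omega)

theorem ObeysLightRayCCR.modes {n : ℕ} {A : Type*} [Ring A] [Algebra ℂ A] {Φ : CircleTest → A}
    (h : ObeysLightRayCCR n Φ) (m m' : ℤ) :
    Φ (modeFunction n m) * Φ (modeFunction n m') - Φ (modeFunction n m') * Φ (modeFunction n m) =
      if m = -m' then algebraMap ℂ A (modePolynomial n m : ℂ) else 0 := by
  rw [h, commutator_modeFunction, circleCoeff_modeFunction]
  by_cases hm : m = -m'
  · rw [if_pos hm, if_pos (by omega), mul_one]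
  · rw [if_neg hm, if_neg (by omega), mul_zero, map_zero]

theorem ObeysLightRayCCR.commute {n : ℕ} {A : Type*} [Ring A] [Algebra ℂ A] {Φ : CircleTest → A}
    (h : ObeysLightRayCCR n Φ) {m : ℤ} (hm : |m| ≤ n) {a : A}
    (ha : a ∈ Algebra.adjoin ℂ (Set.range Φ)) : Commute (Φ (modeFunction n m)) a := by
  induction ha using Algebra.adjoin_induction with
  | mem x hx =>
    obtain ⟨g, rfl⟩ := hx
    have := h (modeFunction n m) g
    rw [commutator_modeFunction, modePolynomial_eq_zero hm, Int.cast_zero, zero_mul, map_zero]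
      at this
    exact sub_eq_zero.1 this
  | algebraMap c => exact (Algebra.commutes c _).symm
  | add x y _ _ hx hy => exact hx.add_right hy
  | mul x y _ _ hx hy => exact hx.mul_right hy

/-! ### Laguerre functions -/

theorem integrableOn_pow_mul_exp_neg_mul (k : ℕ) {c : ℂ} (hc : 0 < c.re) :
    IntegrableOn (fun p : ℝ => (p : ℂ) ^ k * Complex.exp (-(c * p))) (Set.Ioi 0) := by
  have h := integrableOn_rpow_mul_exp_neg_mul_rpow (s := k) (p := 1) (b := c.re)
    (by have : (0 : ℝ) ≤ k := k.cast_nonneg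
        linarith) one_pos hc
  refine Integrable.mono' h (by fun_prop) ?_
  filter_upwards [ae_restrict_mem measurableSet_Ioi] with p hp
  rw [norm_mul, norm_pow, Complex.norm_real, Complex.norm_exp, Real.norm_of_nonneg (le_of_lt hp)]
  simp

theorem integral_pow_mul_exp_neg_mul (k : ℕ) {c : ℂ} (hc : 0 < c.re) :
    ∫ p in Set.Ioi (0 : ℝ), (p : ℂ) ^ k * Complex.exp (-(c * p)) =
      (k.factorial : ℂ) * c⁻¹ ^ (k + 1) := by
  have hc0 : c ≠ 0 := fun h => by simp [h] at hc
  induction k with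
  | zero =>
    have := integral_exp_mul_complex_Ioi (a := -c) (by simpa using hc) 0
    simp only [neg_mul] at this
    simp [this]
  | succ k ih =>
    have hd (p : ℝ) : HasDerivAt (fun p : ℝ => (p : ℂ) ^ (k + 1) * Complex.exp (-(c * p)))
        ((k + 1) * ((p : ℂ) ^ k * Complex.exp (-(c * p))) -
          c * ((p : ℂ) ^ (k + 1) * Complex.exp (-(c * p)))) p := by
      have h0 := Complex.ofRealCLM.hasDerivAt (x := p)
      convert! (h0.pow (k + 1)).mul (h0.const_mul c).neg.cexp using 1
      simp
      ring
    have hk := integrableOn_pow_mul_exp_neg_mul k hc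
    have hk1 := integrableOn_pow_mul_exp_neg_mul (k + 1) hc
    have hlim : Filter.Tendsto (fun p : ℝ => (p : ℂ) ^ (k + 1) * Complex.exp (-(c * p)))
        Filter.atTop (nhds 0) := by
      rw [tendsto_zero_iff_norm_tendsto_zero]
      refine (tendsto_rpow_mul_exp_neg_mul_atTop_nhds_zero (k + 1 : ℕ) c.re hc).congr' ?_
      filter_upwards [Filter.eventually_ge_atTop 0] with p hp
      rw [norm_mul, norm_pow, Complex.norm_real, Complex.norm_exp, Real.norm_of_nonneg hp,
        Real.rpow_natCast]
      simp
    have h := integral_Ioi_of_hasDerivAt_of_tendsto' (a := 0) (fun p _ => hd p)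
      ((hk.const_mul (k + 1 : ℂ)).sub (hk1.const_mul c)) hlim
    rw [integral_sub (hk.const_mul (k + 1 : ℂ)) (hk1.const_mul c), integral_const_mul,
      integral_const_mul, ih] at h
    simp only [Complex.ofReal_zero, zero_pow (Nat.succ_ne_zero k), zero_mul, sub_zero] at h
    have h' := sub_eq_zero.1 h
    rw [Nat.factorial_succ]
    apply mul_left_cancel₀ hc0
    rw [← h', pow_succ _ (k + 1)]
    push_cast
    field_simp

/-- The polynomials `∑_j (-1)^(r-j) (r choose j) (2 p)^j / (N + j)!`, which are up to normalization
the Laguerre polynomials `L_r^(N) (2 p)`. -/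
def laguerre (N r : ℕ) (p : ℝ) : ℝ :=
  ∑ j ∈ Finset.range (r + 1), (-1) ^ (r - j) * r.choose j * 2 ^ j / (N + j).factorial * p ^ j

/-- The Laguerre functions `p ^ N exp (- p) L_r^(N) (2 p)` on the half-line, extended by zero. -/
def laguerreFunction (N r : ℕ) : ℝ → ℂ :=
  (Set.Ioi 0).indicator fun p => ((p ^ N * Real.exp (-p) * laguerre N r p : ℝ) : ℂ)

theorem continuous_laguerre (N r : ℕ) : Continuous (laguerre N r) := by
  unfold laguerre
  fun_prop

/-- The factor `p ^ N` with `N ≠ 0` makes the extension by zero continuous at the origin. -/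
theorem continuous_laguerreFunction {N : ℕ} (hN : N ≠ 0) (r : ℕ) :
    Continuous (laguerreFunction N r) := by
  have h := continuous_laguerre N r
  refine continuous_indicator (fun p hp => ?_) (by fun_prop)
  rw [frontier_Ioi, Set.mem_singleton_iff] at hp
  simp [hp, hN]

theorem laguerreFunction_mul_exp_eq (N r : ℕ) (c : ℂ) :
    (fun p : ℝ => laguerreFunction N r p * Complex.exp (-(c * p))) =
    (Set.Ioi 0).indicator fun p : ℝ => ∑ j ∈ Finset.range (r + 1),
      ((-1) ^ (r - j) * r.choose j * 2 ^ j / (N + j).factorial : ℂ) *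
        ((p : ℂ) ^ (N + j) * Complex.exp (-((1 + c) * p))) := by
  funext p
  by_cases hp : p ∈ Set.Ioi (0 : ℝ)
  · rw [laguerreFunction, Set.indicator_of_mem hp, Set.indicator_of_mem hp, laguerre]
    push_cast
    rw [Finset.mul_sum, Finset.sum_mul]
    refine Finset.sum_congr rfl fun j _ => ?_
    rw [show -((1 + c) * (p : ℂ)) = -p + -(c * p) by ring, Complex.exp_add]
    ring
  · rw [laguerreFunction, Set.indicator_of_notMem hp, Set.indicator_of_notMem hp, zero_mul]

theorem integrable_laguerreFunction_mul_exp (N r : ℕ) {c : ℂ} (hc : 0 < (1 + c).re) :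
    Integrable fun p : ℝ => laguerreFunction N r p * Complex.exp (-(c * p)) := by
  rw [laguerreFunction_mul_exp_eq, integrable_indicator_iff measurableSet_Ioi]
  exact integrable_finsetSum _ fun j _ =>
    (integrableOn_pow_mul_exp_neg_mul (N + j) hc).const_mul _

theorem integrable_laguerreFunction (N r : ℕ) : Integrable (laguerreFunction N r) := by
  simpa using integrable_laguerreFunction_mul_exp N r (c := 0) (by simp)

/-- The Laplace transform of a Laguerre function is `(1 - c) ^ r / (1 + c) ^ (r + N + 1)`. -/
theorem integral_laguerreFunction_mul_exp (N r : ℕ) {c : ℂ} (hc : 0 < (1 + c).re) :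
    ∫ p : ℝ, laguerreFunction N r p * Complex.exp (-(c * p)) =
      (1 - c) ^ r * (1 + c)⁻¹ ^ (r + N + 1) := by
  have hc0 : 1 + c ≠ 0 := fun h => by simp [h] at hc
  rw [laguerreFunction_mul_exp_eq, integral_indicator measurableSet_Ioi, integral_finsetSum _
    fun j _ => (integrableOn_pow_mul_exp_neg_mul (N + j) hc).const_mul _]
  -- The binomial theorem for `(1 - c) / (1 + c) = 2 / (1 + c) - 1` reproduces the coefficients.
  have h : (1 - c) * (1 + c)⁻¹ = 2 * (1 + c)⁻¹ + -1 := by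
    field_simp
    ring
  rw [add_assoc, pow_add, ← mul_assoc, ← mul_pow, h, add_pow, Finset.sum_mul]
  refine Finset.sum_congr rfl fun j _ => ?_
  rw [integral_const_mul, integral_pow_mul_exp_neg_mul (N + j) hc]
  have := Nat.cast_ne_zero (R := ℂ).2 (N + j).factorial_ne_zero
  field_simp
  ring

/-- The density against which test functions are integrated in Fourier transforms is integrable: it
is `1 / (1 + x ^ 2)` times a bounded function. -/
theorem integrable_inv_mul_inv_pow {N : ℕ} (hN : N ≠ 0) :
    Integrable fun x : ℝ => (1 - Complex.I * x)⁻¹ * (1 + Complex.I * x)⁻¹ ^ N := by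
  have h1 : Continuous fun x : ℝ => (1 - Complex.I * x : ℂ)⁻¹ :=
    Continuous.inv₀ (by fun_prop) one_sub_I_mul_ne_zero
  have h2 : Continuous fun x : ℝ => (1 + Complex.I * x : ℂ)⁻¹ :=
    Continuous.inv₀ (by fun_prop) one_add_I_mul_ne_zero
  refine Integrable.mono' integrable_inv_one_add_sq (h1.mul (h2.pow N)).aestronglyMeasurable
    (Filter.Eventually.of_forall fun x => ?_)
  obtain ⟨M, rfl⟩ := Nat.exists_eq_succ_of_ne_zero hN
  have h3 : ‖(1 + Complex.I * x : ℂ)⁻¹‖ ≤ 1 := by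
    rw [norm_inv]
    refine inv_le_one_of_one_le₀ ?_
    refine le_trans ?_ (Complex.abs_re_le_norm _)
    simp
  rw [pow_succ', ← mul_assoc, ← mul_inv, one_sub_I_mul_mul_one_add, norm_mul, norm_inv,
    Complex.norm_real, Real.norm_of_nonneg (by positivity), norm_pow]
  exact mul_le_of_le_one_right (by positivity) (pow_le_one₀ (norm_nonneg _) h3)

theorem inv_mul_inv_pow_mul_zpow_neg (N r : ℕ) (x : ℝ) :
    (1 - Complex.I * x)⁻¹ * (1 + Complex.I * x)⁻¹ ^ N * (cayley x : ℂ) ^ (-1 - r : ℤ) =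
      (1 - Complex.I * x) ^ r * (1 + Complex.I * x)⁻¹ ^ (r + N + 1) := by
  have hne := one_sub_I_mul_ne_zero x
  have hpe := one_add_I_mul_ne_zero x
  rw [show (-1 - r : ℤ) = -((r + 1 : ℕ) : ℤ) by push_cast; ring, zpow_neg, zpow_natCast, coe_cayley,
    div_pow, inv_div, inv_pow, inv_pow]
  field_simp
  ring

theorem inv_mul_inv_pow_mul_zpow_add (N r : ℕ) (x : ℝ) :
    (1 - Complex.I * x)⁻¹ * (1 + Complex.I * x)⁻¹ ^ N * (cayley x : ℂ) ^ (r + N : ℤ) =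
      (1 + Complex.I * x) ^ r * (1 - Complex.I * x)⁻¹ ^ (r + N + 1) := by
  have hne := one_sub_I_mul_ne_zero x
  have hpe := one_add_I_mul_ne_zero x
  rw [show (r + N : ℤ) = ((r + N : ℕ) : ℤ) by push_cast; ring, zpow_natCast, coe_cayley,
    div_pow, inv_pow, inv_pow]
  field_simp
  ring

/-- The Fourier transform of `(1 - i x) ^ r / (1 + i x) ^ (r + N + 1)` is a Laguerre function, by
Fourier inversion. -/
theorem integral_pow_mul_inv_pow_mul_exp {N : ℕ} (hN : N ≠ 0) (r : ℕ) (p : ℝ) :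
    ∫ x : ℝ, (1 - Complex.I * x) ^ r * (1 + Complex.I * x)⁻¹ ^ (r + N + 1) *
      Complex.exp (Complex.I * p * x) = 2 * Real.pi * laguerreFunction N r p := by
  have hF : FourierTransform.fourier (laguerreFunction N r) = fun ξ : ℝ =>
      (1 - Complex.I * (2 * Real.pi * ξ : ℝ)) ^ r *
        (1 + Complex.I * (2 * Real.pi * ξ : ℝ))⁻¹ ^ (r + N + 1) := by
    funext ξ
    rw [Real.fourier_real_eq_integral_exp_smul, ← integral_laguerreFunction_mul_exp N r (by simp)]
    congr 1
    funext p
    rw [smul_eq_mul, mul_comm]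
    congr 2
    push_cast
    ring
  have hψ : Integrable fun x : ℝ =>
      (1 - Complex.I * x) ^ r * (1 + Complex.I * x)⁻¹ ^ (r + N + 1) := by
    have h2 : Continuous fun x : ℝ => (cayley x : ℂ) ^ (-1 - r : ℤ) := by
      refine Continuous.zpow₀ ?_ _ fun x => Or.inl (Circle.coe_ne_zero _)
      exact continuous_subtype_val.comp (Circle.exp.continuous.comp (by fun_prop))
    have h1 := (integrable_inv_mul_inv_pow hN).mul_bdd (c := 1) h2.aestronglyMeasurable
      (Filter.Eventually.of_forall fun x => by rw [norm_zpow, Circle.norm_coe, one_zpow])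
    simpa only [inv_mul_inv_pow_mul_zpow_neg] using h1
  have hpi := Real.two_pi_pos
  have hFi : Integrable (FourierTransform.fourier (laguerreFunction N r)) := by
    rw [hF]
    exact hψ.comp_mul_left' hpi.ne'
  have h := congrFun ((continuous_laguerreFunction hN r).fourierInv_fourier_eq
    (integrable_laguerreFunction N r) hFi) p
  rw [Real.fourierInv_eq', hF] at h
  have h3 := Measure.integral_comp_mul_left (fun x : ℝ =>
    (1 - Complex.I * x) ^ r * (1 + Complex.I * x)⁻¹ ^ (r + N + 1) *
      Complex.exp (Complex.I * p * x)) (2 * Real.pi)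
  rw [abs_of_pos (inv_pos.2 hpi), Complex.real_smul] at h3
  rw [← h]
  have h4 : (∫ v : ℝ, Complex.exp (((2 * Real.pi * inner ℝ v p : ℝ) : ℂ) * Complex.I) •
      ((1 - Complex.I * (2 * Real.pi * v : ℝ)) ^ r *
        (1 + Complex.I * (2 * Real.pi * v : ℝ))⁻¹ ^ (r + N + 1))) =
      ((2 * Real.pi)⁻¹ : ℝ) * ∫ x : ℝ, (1 - Complex.I * x) ^ r *
        (1 + Complex.I * x)⁻¹ ^ (r + N + 1) * Complex.exp (Complex.I * p * x) := by
    rw [← h3]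
    congr 1
    funext v
    rw [smul_eq_mul, mul_comm]
    congr 2
    simp
    ring
  have hpi' : (2 * Real.pi : ℂ) ≠ 0 := by exact_mod_cast hpi.ne'
  rw [h4, ← mul_assoc]
  push_cast
  rw [mul_inv_cancel₀ hpi', one_mul]

/-! ### Orthogonality of the Laguerre functions -/

theorem integrableOn_real_pow_mul_exp (k : ℕ) :
    IntegrableOn (fun p : ℝ => p ^ k * Real.exp (-(2 * p))) (Set.Ioi 0) := by
  have h := (integrableOn_pow_mul_exp_neg_mul k (c := 2) (by norm_num)).re
  refine h.congr (Filter.Eventually.of_forall fun p => ?_)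
  simp only []
  have : (p : ℂ) ^ k * Complex.exp (-(2 * p)) = ((p ^ k * Real.exp (-(2 * p)) : ℝ) : ℂ) := by
    push_cast; rfl
  rw [this]
  exact Complex.ofReal_re _

theorem integral_real_pow_mul_exp (k : ℕ) :
    ∫ p in Set.Ioi (0 : ℝ), p ^ k * Real.exp (-(2 * p)) = k.factorial / 2 ^ (k + 1) := by
  have h := integral_pow_mul_exp_neg_mul k (c := 2) (by norm_num)
  have h2 := integral_ofReal (𝕜 := ℂ) (μ := volume.restrict (Set.Ioi (0 : ℝ)))
    (f := fun p : ℝ => p ^ k * Real.exp (-(2 * p)))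
  apply Complex.ofReal_injective
  refine h2.symm.trans (Eq.trans ?_ (h.trans ?_))
  · congr 1
    funext p
    simp
  · push_cast
    rw [inv_pow, div_eq_mul_inv]

/-- Moments of the Laguerre functions as finite differences of the polynomial
`(x + N + 1) ⋯ (x + N + k)`. -/
theorem integral_laguerre_mul_pow (N r k : ℕ) :
    IntegrableOn (fun p : ℝ => p ^ N * Real.exp (-(2 * p)) * laguerre N r p * p ^ k) (Set.Ioi 0) ∧
    ∫ p in Set.Ioi (0 : ℝ), p ^ N * Real.exp (-(2 * p)) * laguerre N r p * p ^ k =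
      (2 ^ (N + k + 1) : ℝ)⁻¹ * (fwdDiff 1)^[r]
        (((ascPochhammer ℝ k).comp (Polynomial.X + Polynomial.C (N + 1 : ℝ))).eval) 0 := by
  have e : (fun p : ℝ => p ^ N * Real.exp (-(2 * p)) * laguerre N r p * p ^ k) =
      fun p => ∑ j ∈ Finset.range (r + 1),
        ((-1) ^ (r - j) * r.choose j * 2 ^ j / (N + j).factorial : ℝ) *
          (p ^ (N + j + k) * Real.exp (-(2 * p))) := by
    funext p
    rw [laguerre, Finset.mul_sum, Finset.sum_mul]
    refine Finset.sum_congr rfl fun j _ => ?_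
    ring
  have hi (j : ℕ) := (integrableOn_real_pow_mul_exp (N + j + k)).const_mul
    ((-1) ^ (r - j) * r.choose j * 2 ^ j / (N + j).factorial : ℝ)
  rw [e]
  refine ⟨integrable_finsetSum _ fun j _ => hi j, ?_⟩
  rw [integral_finsetSum _ fun j _ => hi j, fwdDiff_iter_eq_sum_shift, Finset.mul_sum]
  refine Finset.sum_congr rfl fun j _ => ?_
  rw [integral_const_mul, integral_real_pow_mul_exp]
  have h : (((ascPochhammer ℝ k).comp (Polynomial.X + Polynomial.C (N + 1 : ℝ))).eval
      (0 + j • (1 : ℝ))) * (N + j).factorial = (N + j + k).factorial := by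
    have : (0 + j • (1 : ℝ)) + (N + 1) = ((N + j + 1 : ℕ) : ℝ) := by
      rw [nsmul_eq_mul]; push_cast; ring
    rw [Polynomial.eval_comp, Polynomial.eval_add, Polynomial.eval_X, Polynomial.eval_C, this,
      ascPochhammer_nat_eq_natCast_ascFactorial, ← Nat.cast_mul, mul_comm,
      Nat.factorial_mul_ascFactorial]
  rw [← h, zsmul_eq_mul]
  have := Nat.cast_ne_zero (R := ℝ).2 (N + j).factorial_ne_zero
  push_cast
  field_simp
  ring

theorem integral_laguerre_mul_pow_of_lt (N : ℕ) {r k : ℕ} (h : k < r) :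
    ∫ p in Set.Ioi (0 : ℝ), p ^ N * Real.exp (-(2 * p)) * laguerre N r p * p ^ k = 0 := by
  rw [(integral_laguerre_mul_pow N r k).2, Polynomial.fwdDiff_iter_eq_zero_of_degree_lt, Pi.zero_apply,
    mul_zero]
  rwa [Polynomial.natDegree_comp, ascPochhammer_natDegree, Polynomial.natDegree_X_add_C, mul_one]

theorem integral_laguerre_mul_pow_self (N r : ℕ) :
    ∫ p in Set.Ioi (0 : ℝ), p ^ N * Real.exp (-(2 * p)) * laguerre N r p * p ^ r =
      r.factorial / 2 ^ (N + r + 1) := by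
  have hd : ((ascPochhammer ℝ r).comp (Polynomial.X + Polynomial.C (N + 1 : ℝ))).natDegree = r := by
    rw [Polynomial.natDegree_comp, ascPochhammer_natDegree, Polynomial.natDegree_X_add_C, mul_one]
  have hm : ((ascPochhammer ℝ r).comp (Polynomial.X + Polynomial.C (N + 1 : ℝ))).Monic :=
    (monic_ascPochhammer ℝ r).comp_X_add_C _
  have h := Polynomial.fwdDiff_iter_degree_eq_factorial
    ((ascPochhammer ℝ r).comp (Polynomial.X + Polynomial.C (N + 1 : ℝ)))
  rw [hd, hm.leadingCoeff, one_smul] at h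
  rw [(integral_laguerre_mul_pow N r r).2, h]
  simp [div_eq_inv_mul]

theorem laguerre_mul_laguerre_eq (N r r' : ℕ) :
    (fun p : ℝ => p ^ N * Real.exp (-(2 * p)) * (laguerre N r p * laguerre N r' p)) =
      fun p => ∑ j ∈ Finset.range (r' + 1),
        ((-1) ^ (r' - j) * r'.choose j * 2 ^ j / (N + j).factorial : ℝ) *
          (p ^ N * Real.exp (-(2 * p)) * laguerre N r p * p ^ j) := by
  funext p
  rw [← mul_assoc, laguerre.eq_1 N r' p, Finset.mul_sum]
  refine Finset.sum_congr rfl fun j _ => ?_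
  ring

theorem integrableOn_laguerre_mul_laguerre (N r r' : ℕ) :
    IntegrableOn (fun p : ℝ => p ^ N * Real.exp (-(2 * p)) * (laguerre N r p * laguerre N r' p))
      (Set.Ioi 0) := by
  rw [laguerre_mul_laguerre_eq]
  exact integrable_finsetSum _ fun j _ => (integral_laguerre_mul_pow N r j).1.const_mul _

theorem integral_laguerre_mul_laguerre_of_lt (N : ℕ) {r r' : ℕ} (h : r' < r) :
    ∫ p in Set.Ioi (0 : ℝ), p ^ N * Real.exp (-(2 * p)) * (laguerre N r p * laguerre N r' p) =
      0 := by
  rw [laguerre_mul_laguerre_eq, integral_finsetSum _ fun j _ =>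
    (integral_laguerre_mul_pow N r j).1.const_mul _]
  refine Finset.sum_eq_zero fun j hj => ?_
  rw [Finset.mem_range] at hj
  rw [integral_const_mul, integral_laguerre_mul_pow_of_lt N (by omega), mul_zero]

/-- The orthogonality relation of the Laguerre functions. -/
theorem integral_laguerre_mul_laguerre (N r r' : ℕ) :
    ∫ p in Set.Ioi (0 : ℝ), p ^ N * Real.exp (-(2 * p)) * (laguerre N r p * laguerre N r' p) =
      if r = r' then (r.factorial / ((N + r).factorial * 2 ^ (N + 1)) : ℝ) else 0 := by
  rcases lt_trichotomy r r' with h | rfl | h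
  · rw [if_neg h.ne]
    simp only [mul_comm (laguerre N r _)]
    exact integral_laguerre_mul_laguerre_of_lt N h
  · rw [if_pos rfl, laguerre_mul_laguerre_eq, integral_finsetSum _ fun j _ =>
      (integral_laguerre_mul_pow N r j).1.const_mul _, Finset.sum_range_succ, Finset.sum_eq_zero,
      integral_const_mul, integral_laguerre_mul_pow_self]
    · have := Nat.cast_ne_zero (R := ℝ).2 (N + r).factorial_ne_zero
      rw [Nat.sub_self, Nat.choose_self]
      push_cast
      field_simp
      ring
    · intro j hj
      rw [integral_const_mul, integral_laguerre_mul_pow_of_lt N (Finset.mem_range.1 hj), mul_zero]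
  · rw [if_neg h.ne']
    exact integral_laguerre_mul_laguerre_of_lt N h

/-- A bound which is uniform in `r` and `r'`, from the norms by `2 |a b| ≤ a ^ 2 + b ^ 2`. -/
theorem integral_abs_laguerre_mul_laguerre_le (N r r' : ℕ) :
    ∫ p in Set.Ioi (0 : ℝ), ‖p ^ N * Real.exp (-(2 * p)) * (laguerre N r p * laguerre N r' p)‖ ≤
      1 := by
  have hle (r : ℕ) : ∫ p in Set.Ioi (0 : ℝ),
      p ^ N * Real.exp (-(2 * p)) * (laguerre N r p * laguerre N r p) ≤ 1 := by
    rw [integral_laguerre_mul_laguerre, if_pos rfl]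
    refine div_le_one_of_le₀ ?_ (by positivity)
    have h1 : (r.factorial : ℝ) ≤ (N + r).factorial := by
      exact_mod_cast Nat.factorial_le (Nat.le_add_left r N)
    exact h1.trans (le_mul_of_one_le_right (by positivity) (one_le_pow₀ one_le_two))
  have hi := ((integrableOn_laguerre_mul_laguerre N r r).add
    (integrableOn_laguerre_mul_laguerre N r' r')).div_const 2
  refine (setIntegral_mono_on (integrableOn_laguerre_mul_laguerre N r r').norm hi
    measurableSet_Ioi fun p hp => ?_).trans ?_
  · have hw : 0 ≤ p ^ N * Real.exp (-(2 * p)) :=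
      mul_nonneg (pow_nonneg (le_of_lt hp) _) (Real.exp_pos _).le
    simp only [Pi.add_apply]
    rw [norm_mul, Real.norm_of_nonneg hw, ← mul_add, mul_div_assoc]
    refine mul_le_mul_of_nonneg_left ?_ hw
    rw [Real.norm_eq_abs, abs_mul]
    have h1 := abs_mul_abs_self (laguerre N r p)
    have h2 := abs_mul_abs_self (laguerre N r' p)
    nlinarith [sq_nonneg (|laguerre N r p| - |laguerre N r' p|)]
  · rw [integral_div]
    simp only [Pi.add_apply]
    rw [integral_add (integrableOn_laguerre_mul_laguerre N r r)
      (integrableOn_laguerre_mul_laguerre N r' r')]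
    linarith [hle r, hle r']

/-! ### The two-point function in Fourier modes -/

theorem prod_natCast_sub_of_nonneg_of_lt {N : ℕ} {s : ℤ} (h0 : 0 ≤ s) (h : s < N) :
    ∏ j ∈ Finset.range N, ((j : ℂ) - s) = 0 := by
  refine Finset.prod_eq_zero (i := s.toNat) (Finset.mem_range.2 (by omega)) ?_
  have : ((s.toNat : ℕ) : ℂ) = s := by
    exact_mod_cast congrArg (Int.cast : ℤ → ℂ) (Int.toNat_of_nonneg h0)
  rw [this, sub_self]

theorem prod_natCast_sub_neg (N r : ℕ) :
    ∏ j ∈ Finset.range N, ((j : ℂ) - (-1 - r : ℤ)) = ((r + 1).ascFactorial N : ℂ) := by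
  rw [Nat.ascFactorial_eq_prod_range]
  push_cast
  exact Finset.prod_congr rfl fun j _ => by ring

theorem prod_natCast_sub_add (N r : ℕ) :
    ∏ j ∈ Finset.range N, ((j : ℂ) - (r + N : ℤ)) = (-1) ^ N * ((r + 1).ascFactorial N : ℂ) := by
  have h : (-1 : ℂ) ^ N = ∏ _j ∈ Finset.range N, (-1 : ℂ) := by simp
  rw [Nat.ascFactorial_eq_prod_range, ← Finset.prod_range_reflect, h]
  push_cast
  rw [← Finset.prod_mul_distrib]
  refine Finset.prod_congr rfl fun j hj => ?_
  rw [Finset.mem_range] at hj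
  rw [Nat.sub_sub, Nat.cast_sub (by omega)]
  push_cast
  ring

/-- The Fourier transform of `(1 - i x)⁻¹ (1 + i x)⁻ᴺ f (z)`, term by term. -/
theorem hasSum_integral_cayley_mul_exp {N : ℕ} (hN : N ≠ 0) (f : CircleTest) (p : ℝ) :
    HasSum (fun s : ℤ => circleCoeff s f * ∫ x : ℝ, (1 - Complex.I * x)⁻¹ *
        (1 + Complex.I * x)⁻¹ ^ N * (cayley x : ℂ) ^ s * Complex.exp (Complex.I * p * x))
      (∫ x : ℝ, (1 - Complex.I * x)⁻¹ * (1 + Complex.I * x)⁻¹ ^ N *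
        (f : Circle → ℂ) (cayley x) * Complex.exp (Complex.I * p * x)) := by
  have h1 : Integrable (fun x : ℝ => (1 - Complex.I * x)⁻¹ * (1 + Complex.I * x)⁻¹ ^ N *
      Complex.exp (Complex.I * p * x)) := by
    refine (integrable_inv_mul_inv_pow hN).mul_bdd (c := 1) (by fun_prop)
      (Filter.Eventually.of_forall fun x => ?_)
    rw [show Complex.I * p * x = ((p * x : ℝ) : ℂ) * Complex.I by push_cast; ring,
      Complex.norm_exp_ofReal_mul_I]
  have h := hasSum_integral_circleCoeff h1 (τ := fun x => 2 * Real.arctan x) (by fun_prop) f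
  simp only [mul_right_comm _ (Complex.exp _)] at h
  exact h

theorem integral_mode_neg_mul_exp {N : ℕ} (hN : N ≠ 0) (r : ℕ) (p : ℝ) :
    ∫ x : ℝ, (1 - Complex.I * x)⁻¹ * (1 + Complex.I * x)⁻¹ ^ N * (cayley x : ℂ) ^ (-1 - r : ℤ) *
      Complex.exp (Complex.I * p * x) = 2 * Real.pi * laguerreFunction N r p := by
  simp only [inv_mul_inv_pow_mul_zpow_neg]
  exact integral_pow_mul_inv_pow_mul_exp hN r p

theorem integral_mode_add_mul_exp {N : ℕ} (hN : N ≠ 0) (r : ℕ) (p : ℝ) :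
    ∫ x : ℝ, (1 - Complex.I * x)⁻¹ * (1 + Complex.I * x)⁻¹ ^ N * (cayley x : ℂ) ^ (r + N : ℤ) *
      Complex.exp (Complex.I * p * x) = 2 * Real.pi * laguerreFunction N r (-p) := by
  rw [← integral_pow_mul_inv_pow_mul_exp hN, ← integral_neg_eq_self]
  congr 1
  funext x
  rw [inv_mul_inv_pow_mul_zpow_add]
  push_cast
  simp only [mul_neg, neg_mul, ← sub_eq_add_neg, sub_neg_eq_add]

theorem laguerreFunction_of_nonpos (N r : ℕ) {p : ℝ} (hp : p ≤ 0) : laguerreFunction N r p = 0 :=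
  Set.indicator_of_notMem (by simpa using hp) _

/-- On the positive momentum axis only the negative modes contribute. -/
theorem hasSum_integral_bolOperator {N : ℕ} (hN : N ≠ 0) (f : CircleTest) {p : ℝ} (hp : 0 < p) :
    HasSum (fun r : ℕ => circleCoeff (-1 - r) (bolOperator N f) *
        (2 * Real.pi * laguerreFunction N r p))
      (∫ x : ℝ, (1 - Complex.I * x)⁻¹ * (1 + Complex.I * x)⁻¹ ^ N *
        (bolOperator N f : Circle → ℂ) (cayley x) * Complex.exp (Complex.I * p * x)) := by
  have h := hasSum_integral_cayley_mul_exp hN (bolOperator N f) p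
  have hinj : Function.Injective fun r : ℕ => (-1 - r : ℤ) := fun a b hab => by
    simpa using hab
  rw [← hinj.hasSum_iff] at h
  · simpa only [Function.comp_def, integral_mode_neg_mul_exp hN] using h
  · intro s hs
    rcases lt_or_ge s 0 with h0 | h0
    · exact absurd ⟨(-1 - s).toNat, by simp only []; omega⟩ hs
    rcases lt_or_ge s N with h1 | h1
    · rw [circleCoeff_bolOperator, prod_natCast_sub_of_nonneg_of_lt h0 h1, zero_mul, zero_mul]
    · obtain ⟨r, rfl⟩ : ∃ r : ℕ, s = r + N := ⟨(s - N).toNat, by omega⟩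
      rw [integral_mode_add_mul_exp hN, laguerreFunction_of_nonpos _ _ (by linarith), mul_zero,
        mul_zero]

/-- On the negative momentum axis only the positive modes contribute. -/
theorem hasSum_integral_bolOperator_neg {N : ℕ} (hN : N ≠ 0) (f : CircleTest) {p : ℝ}
    (hp : 0 < p) :
    HasSum (fun r : ℕ => circleCoeff (r + N) (bolOperator N f) *
        (2 * Real.pi * laguerreFunction N r p))
      (∫ x : ℝ, (1 - Complex.I * x)⁻¹ * (1 + Complex.I * x)⁻¹ ^ N *
        (bolOperator N f : Circle → ℂ) (cayley x) *
          Complex.exp (Complex.I * (-p : ℝ) * x)) := by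
  have h := hasSum_integral_cayley_mul_exp hN (bolOperator N f) (-p)
  have hinj : Function.Injective fun r : ℕ => (r + N : ℤ) := fun a b hab => by
    simpa using hab
  rw [← hinj.hasSum_iff] at h
  · simpa only [Function.comp_def, integral_mode_add_mul_exp hN, neg_neg] using h
  · intro s hs
    rcases lt_or_ge s 0 with h0 | h0
    · obtain ⟨r, rfl⟩ : ∃ r : ℕ, s = -1 - r := ⟨(-1 - s).toNat, by omega⟩
      rw [integral_mode_neg_mul_exp hN, laguerreFunction_of_nonpos _ _ (by linarith), mul_zero,
        mul_zero]
    rcases lt_or_ge s N with h1 | h1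
    · rw [circleCoeff_bolOperator, prod_natCast_sub_of_nonneg_of_lt h0 h1, zero_mul, zero_mul]
    · exact absurd ⟨(s - N).toNat, by simp only []; omega⟩ hs

theorem waveFunction_eq (n : ℕ) (f : CircleTest) (p : ℝ) :
    waveFunction n f p = (-1) ^ n * ((-(Complex.I * p)) ^ (n + 1))⁻¹ *
      ((-2 * Complex.I) ^ (2 * n + 1) / 2 ^ n * ∫ x : ℝ, (1 - Complex.I * x)⁻¹ *
        (1 + Complex.I * x)⁻¹ ^ (2 * n + 1) * (bolOperator (2 * n + 1) f : Circle → ℂ) (cayley x) *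
          Complex.exp (Complex.I * p * x)) := by
  rw [waveFunction, ← integral_const_mul ((-2 * Complex.I) ^ (2 * n + 1) / 2 ^ n)]
  congr 2
  funext x
  rw [iteratedDeriv_hat]
  ring

/-- The product of two Laguerre functions in the two-point function. -/
theorem inv_pow_mul_laguerreFunction_mul (N r r' : ℕ) {p : ℝ} (hp : 0 < p) :
    ((p : ℂ) ^ N)⁻¹ * (laguerreFunction N r p * laguerreFunction N r' p) =
      ((p ^ N * Real.exp (-(2 * p)) * (laguerre N r p * laguerre N r' p) : ℝ) : ℂ) := by
  have hp' : (p : ℂ) ≠ 0 := Complex.ofReal_ne_zero.2 hp.ne'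
  rw [laguerreFunction, laguerreFunction, Set.indicator_of_mem (Set.mem_Ioi.2 hp),
    Set.indicator_of_mem (Set.mem_Ioi.2 hp), show -(2 * p) = -p + -p by ring, Real.exp_add]
  push_cast
  field_simp

theorem four_pow_two_point_constant (n : ℕ) :
    (((-2 * Complex.I) ^ (2 * n + 1) / 2 ^ n) ^ 2 : ℂ) = -2 ^ (2 * n + 2) := by
  have h : (4 : ℂ) ^ n = 2 ^ n * 2 ^ n := by rw [← mul_pow]; norm_num
  have e : ((-1 : ℂ) ^ n) * (-1) ^ n = 1 := by rw [← mul_pow]; norm_num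
  have h0 : (2 : ℂ) ^ n ≠ 0 := pow_ne_zero n two_ne_zero
  rw [neg_two_mul_I_pow, h, div_pow, div_eq_iff (pow_ne_zero 2 h0), pow_add 2 (2 * n), pow_mul' 2 2 n]
  linear_combination (4 * Complex.I ^ 2 * (2 ^ n) ^ 4) * e + (4 * (2 ^ n) ^ 4) * Complex.I_sq

theorem momentum_factors_mul {A B F G K P p e : ℂ} (h : A * B * p = P) (he : e * e = 1) :
    p * (e * A * (K * F)) * (e * B * (K * G)) = K ^ 2 * P * (F * G) := by
  rw [← h]
  linear_combination (A * B * p * K ^ 2 * F * G) * he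

theorem hasSum_const_mul_mul {a b : ℕ → ℂ} {F G : ℂ} (hf : HasSum a F) (hg : HasSum b G) (c : ℂ) :
    HasSum (fun r : ℕ × ℕ => c * (a r.1 * b r.2)) (c * (F * G)) :=
  (hf.mul hg (summable_mul_of_summable_norm hf.summable.norm hg.summable.norm)).mul_left c

/-- The integrand of the two-point function at positive momentum, expanded in Laguerre functions. -/
theorem hasSum_twoPoint_integrand (n : ℕ) (f g : CircleTest) {p : ℝ} (hp : 0 < p) :
    HasSum (fun r : ℕ × ℕ => -(2 ^ (2 * n + 2) * (2 * Real.pi) ^ 2 : ℂ) *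
        (circleCoeff (r.1 + (2 * n + 1 : ℕ)) (bolOperator (2 * n + 1) f) *
          circleCoeff (-1 - r.2) (bolOperator (2 * n + 1) g)) *
        ((p ^ (2 * n + 1) * Real.exp (-(2 * p)) *
          (laguerre (2 * n + 1) r.1 p * laguerre (2 * n + 1) r.2 p) : ℝ) : ℂ))
      ((p : ℂ) * waveFunction n f (-p) * waveFunction n g p) := by
  have hN : 2 * n + 1 ≠ 0 := by omega
  have hp' : (p : ℂ) ≠ 0 := Complex.ofReal_ne_zero.2 hp.ne'
  have hf := hasSum_integral_bolOperator_neg hN f hp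
  have hg := hasSum_integral_bolOperator hN g hp
  have h := hasSum_const_mul_mul hf hg
    (((-2 * Complex.I) ^ (2 * n + 1) / 2 ^ n) ^ 2 * ((p : ℂ) ^ (2 * n + 1))⁻¹)
  have e1 : ((-(Complex.I * (-p : ℝ))) ^ (n + 1))⁻¹ * ((-(Complex.I * (p : ℂ))) ^ (n + 1))⁻¹ * p =
      ((p : ℂ) ^ (2 * n + 1))⁻¹ := by
    rw [← mul_inv, ← mul_pow, show -(Complex.I * ((-p : ℝ) : ℂ)) * -(Complex.I * p) = p ^ 2 by
      push_cast; linear_combination (-(p : ℂ) ^ 2) * Complex.I_sq]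
    field_simp
    ring
  have e2 : ((-1 : ℂ) ^ n) * (-1) ^ n = 1 := by rw [← mul_pow]; norm_num
  rw [waveFunction_eq, waveFunction_eq, momentum_factors_mul e1 e2]
  convert! h using 1
  funext r
  rw [← inv_pow_mul_laguerreFunction_mul _ _ _ hp, four_pow_two_point_constant]
  ring

/-- The two-point function is the sum over the positive modes `z ^ (n + m)`, `m = r + n + 1`, of
their coefficients in `f` and of those of the opposite modes in `g`, with weight
`(r + 2 n + 1)! / r! = Π^(n) (m)`. -/
theorem hasSum_twoPoint (n : ℕ) (f g : CircleTest) :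
    HasSum (fun r : ℕ => ((r + 1).ascFactorial (2 * n + 1) : ℂ) *
      (circleCoeff (r + (2 * n + 1 : ℕ)) f * circleCoeff (-1 - r) g)) (twoPoint n f g) := by
  have hinj1 : Function.Injective fun r : ℕ => (r + (2 * n + 1 : ℕ) : ℤ) := fun a b hab => by
    simpa using hab
  have hinj2 : Function.Injective fun r : ℕ => (-1 - r : ℤ) := fun a b hab => by
    simpa using hab
  have hs1 := (summable_norm_circleCoeff (bolOperator (2 * n + 1) f)).comp_injective hinj1
  have hs2 := (summable_norm_circleCoeff (bolOperator (2 * n + 1) g)).comp_injective hinj2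
  -- Absolute convergence justifies the exchange of the double sum and the momentum integral, by
  -- which only the diagonal terms survive.
  have hs := hs1.mul_of_nonneg hs2 (fun _ => norm_nonneg _) (fun _ => norm_nonneg _)
  simp only [Function.comp_apply, ← norm_mul] at hs
  have hint := hasSum_integral_of_summable_integral_norm (μ := volume.restrict (Set.Ioi (0 : ℝ)))
    (F := fun (r : ℕ × ℕ) (p : ℝ) => -(2 ^ (2 * n + 2) * (2 * Real.pi) ^ 2 : ℂ) *
        (circleCoeff (r.1 + (2 * n + 1 : ℕ)) (bolOperator (2 * n + 1) f) *
          circleCoeff (-1 - r.2) (bolOperator (2 * n + 1) g)) *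
        ((p ^ (2 * n + 1) * Real.exp (-(2 * p)) *
          (laguerre (2 * n + 1) r.1 p * laguerre (2 * n + 1) r.2 p) : ℝ) : ℂ))
    (fun r => ((integrableOn_laguerre_mul_laguerre _ r.1 r.2).ofReal).const_mul _) (by
      refine (hs.mul_left ‖(2 ^ (2 * n + 2) * (2 * Real.pi) ^ 2 : ℂ)‖).of_nonneg_of_le
        (fun r => integral_nonneg fun p => norm_nonneg _) fun r => ?_
      simp only [norm_mul (_ * _ : ℂ) ((_ : ℝ) : ℂ), integral_const_mul, Complex.norm_real]
      refine (mul_le_of_le_one_right (norm_nonneg _)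
        (integral_abs_laguerre_mul_laguerre_le _ r.1 r.2)).trans ?_
      rw [norm_mul, norm_neg])
  have h1 : (∫ p in Set.Ioi (0 : ℝ), ∑' r : ℕ × ℕ, -(2 ^ (2 * n + 2) * (2 * Real.pi) ^ 2 : ℂ) *
        (circleCoeff (r.1 + (2 * n + 1 : ℕ)) (bolOperator (2 * n + 1) f) *
          circleCoeff (-1 - r.2) (bolOperator (2 * n + 1) g)) *
        ((p ^ (2 * n + 1) * Real.exp (-(2 * p)) *
          (laguerre (2 * n + 1) r.1 p * laguerre (2 * n + 1) r.2 p) : ℝ) : ℂ)) =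
      ∫ p in Set.Ioi (0 : ℝ), (p : ℂ) * waveFunction n f (-p) * waveFunction n g p :=
    setIntegral_congr_fun measurableSet_Ioi fun p hp => (hasSum_twoPoint_integrand n f g hp).tsum_eq
  rw [h1] at hint
  have hdiag : Function.Injective fun r : ℕ => (r, r) := fun a b hab => (Prod.ext_iff.1 hab).1
  rw [← hdiag.hasSum_iff] at hint
  · have h2 := hint.mul_left (1 / (4 * (Real.pi : ℂ) ^ 2))
    rw [twoPoint]
    convert! h2 using 1
    funext r
    have h3 := integral_ofReal (𝕜 := ℂ) (μ := volume.restrict (Set.Ioi (0 : ℝ)))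
      (f := fun p : ℝ => p ^ (2 * n + 1) * Real.exp (-(2 * p)) *
          (laguerre (2 * n + 1) r p * laguerre (2 * n + 1) r p))
    have h4 : ∫ p in Set.Ioi (0 : ℝ), ((p ^ (2 * n + 1) * Real.exp (-(2 * p)) *
        (laguerre (2 * n + 1) r p * laguerre (2 * n + 1) r p) : ℝ) : ℂ) =
        (r.factorial / ((2 * n + 1 + r).factorial * 2 ^ (2 * n + 2)) : ℂ) := by
      refine h3.trans ?_
      rw [integral_laguerre_mul_laguerre, if_pos rfl]
      push_cast
      rfl
    simp only [Function.comp_apply]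
    rw [integral_const_mul, h4, circleCoeff_bolOperator, circleCoeff_bolOperator,
      prod_natCast_sub_neg, prod_natCast_sub_add, add_comm (2 * n + 1) r,
      ← Nat.factorial_mul_ascFactorial]
    have h5 := Nat.cast_ne_zero (R := ℂ).2 r.factorial_ne_zero
    have h6 := Nat.cast_ne_zero (R := ℂ).2 (Nat.ascFactorial_pos r (2 * n + 1)).ne'
    have hpi : (Real.pi : ℂ) ≠ 0 := Complex.ofReal_ne_zero.2 Real.pi_ne_zero
    rw [show ((-1 : ℂ) ^ (2 * n + 1)) = -1 by rw [pow_succ, pow_mul]; norm_num]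
    push_cast
    field_simp
    ring
  · intro r hr
    have hne : r.1 ≠ r.2 := fun h => hr ⟨r.1, Prod.ext rfl h⟩
    rw [integral_const_mul]
    have h3 := integral_ofReal (𝕜 := ℂ) (μ := volume.restrict (Set.Ioi (0 : ℝ)))
      (f := fun p : ℝ => p ^ (2 * n + 1) * Real.exp (-(2 * p)) *
          (laguerre (2 * n + 1) r.1 p * laguerre (2 * n + 1) r.2 p))
    refine (congrArg _ h3).trans ?_
    rw [integral_laguerre_mul_laguerre, if_neg hne]
    simp

/-! ### Properties of the two-point function -/

theorem twoPoint_smul_left (n : ℕ) (c : ℂ) (f g : CircleTest) :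
    twoPoint n (c • f) g = c * twoPoint n f g := by
  refine (hasSum_twoPoint n (c • f) g).unique ?_
  convert! (hasSum_twoPoint n f g).mul_left c using 2 with r
  rw [circleCoeff_smul]
  ring

theorem twoPoint_smul_right (n : ℕ) (c : ℂ) (f g : CircleTest) :
    twoPoint n f (c • g) = c * twoPoint n f g := by
  refine (hasSum_twoPoint n f (c • g)).unique ?_
  convert! (hasSum_twoPoint n f g).mul_left c using 2 with r
  rw [circleCoeff_smul]
  ring

/-- Invariance of the vacuum under rotations. -/
theorem twoPoint_testHamiltonian_left (n : ℕ) (f g : CircleTest) :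
    twoPoint n (testHamiltonian n f) g = -twoPoint n f (testHamiltonian n g) := by
  refine (hasSum_twoPoint n (testHamiltonian n f) g).unique ?_
  convert! (hasSum_twoPoint n f (testHamiltonian n g)).neg using 2 with r
  rw [circleCoeff_testHamiltonian, circleCoeff_testHamiltonian]
  push_cast
  ring

theorem twoPoint_mode_left (n r : ℕ) (g : CircleTest) :
    twoPoint n (modeFunction n (r + n + 1)) g =
      (r + 1).ascFactorial (2 * n + 1) * circleCoeff (-1 - r) g := by
  refine (hasSum_twoPoint n _ g).unique ?_
  convert! hasSum_ite_eq r (((r + 1).ascFactorial (2 * n + 1) : ℂ) * circleCoeff (-1 - r) g)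
    using 2 with r'
  rw [circleCoeff_modeFunction]
  by_cases h : r' = r
  · rw [if_pos h, if_pos (by push_cast; omega), one_mul, h]
  · rw [if_neg h, if_neg (by push_cast; omega), zero_mul, mul_zero]

theorem twoPoint_mode_left_of_le {n : ℕ} {m : ℤ} (hm : m ≤ n) (g : CircleTest) :
    twoPoint n (modeFunction n m) g = 0 := by
  refine (hasSum_twoPoint n _ g).unique ?_
  convert! hasSum_zero (α := ℂ) (β := ℕ) using 2 with r
  rw [circleCoeff_modeFunction, if_neg (by push_cast; omega), zero_mul, mul_zero]

theorem twoPoint_mode_right (n r : ℕ) (f : CircleTest) :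
    twoPoint n f (modeFunction n (-r - n - 1)) =
      (r + 1).ascFactorial (2 * n + 1) * circleCoeff (r + (2 * n + 1 : ℕ)) f := by
  refine (hasSum_twoPoint n f _).unique ?_
  convert! hasSum_ite_eq r (((r + 1).ascFactorial (2 * n + 1) : ℂ) *
    circleCoeff (r + (2 * n + 1 : ℕ)) f) using 2 with r'
  rw [circleCoeff_modeFunction]
  by_cases h : r' = r
  · rw [if_pos h, if_pos (by omega), mul_one, h]
  · rw [if_neg h, if_neg (by omega), mul_zero, mul_zero]

theorem twoPoint_mode_right_of_le {n : ℕ} {m : ℤ} (hm : -n ≤ m) (f : CircleTest) :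
    twoPoint n f (modeFunction n m) = 0 := by
  refine (hasSum_twoPoint n f _).unique ?_
  convert! hasSum_zero (α := ℂ) (β := ℕ) using 2 with r
  rw [circleCoeff_modeFunction, if_neg (by omega), mul_zero, mul_zero]

/-- The antisymmetric part of the two-point function is the light-ray commutator. -/
theorem twoPoint_sub_twoPoint (n : ℕ) (f g : CircleTest) :
    twoPoint n f g - twoPoint n g f = Complex.I / (2 * Real.pi) * (-1) ^ n *
      ∫ x : ℝ, hat n f x * iteratedDeriv (2 * n + 1) (hat n g) x := by
  rw [commutator_eq_circleCoeff]
  refine HasSum.unique ?_ (hasSum_circleCoeff_mul (2 * n) f (bolOperator (2 * n + 1) g))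
  rw [sub_eq_neg_add]
  refine HasSum.of_nat_of_neg_add_one ?_ ?_
  · have hinj : Function.Injective fun r : ℕ => r + (2 * n + 1) := add_left_injective _
    rw [← hinj.hasSum_iff]
    · convert! (hasSum_twoPoint n g f).neg using 2 with r
      simp only [Function.comp_apply]
      rw [circleCoeff_bolOperator, Nat.cast_add r, prod_natCast_sub_add,
        show ((-1 : ℂ) ^ (2 * n + 1)) = -1 by rw [pow_succ, pow_mul]; norm_num,
        show (2 * n - (r + (2 * n + 1 : ℕ)) : ℤ) = -1 - r by push_cast; ring]
      ring
    · intro s hs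
      have h : s < 2 * n + 1 := by
        by_contra h
        exact hs ⟨s - (2 * n + 1), by simp only []; omega⟩
      rw [circleCoeff_bolOperator, prod_natCast_sub_of_nonneg_of_lt (by omega) (by omega),
        zero_mul, zero_mul]
  · convert! hasSum_twoPoint n f g using 2 with r
    rw [show (-(r + 1) : ℤ) = -1 - r by ring, circleCoeff_bolOperator, prod_natCast_sub_neg,
        show (2 * n - (-1 - r) : ℤ) = r + (2 * n + 1 : ℕ) by push_cast; ring]
    ring

/-- Functionals of a test function that may be evaluated term by term in its Fourier series. -/
def IsModeSummable (n : ℕ) (L : CircleTest → ℂ) : Prop :=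
  ∀ f, HasSum (fun s : ℤ => circleCoeff s f * L (modeFunction n (s - n))) (L f)

theorem IsModeSummable.add {n : ℕ} {L L' : CircleTest → ℂ} (h : IsModeSummable n L)
    (h' : IsModeSummable n L') : IsModeSummable n fun f => L f + L' f := fun f => by
  simpa only [mul_add] using (h f).add (h' f)

theorem IsModeSummable.const_mul {n : ℕ} {L : CircleTest → ℂ} (h : IsModeSummable n L) (c : ℂ) :
    IsModeSummable n fun f => c * L f := fun f => by
  simpa only [mul_left_comm] using (h f).mul_left c

theorem IsModeSummable.zero (n : ℕ) : IsModeSummable n fun _ => 0 := fun f => by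
  simpa only [mul_zero] using hasSum_zero

theorem IsModeSummable.eq_zero {n : ℕ} {L : CircleTest → ℂ} (h : IsModeSummable n L)
    (h0 : ∀ m, L (modeFunction n m) = 0) (f : CircleTest) : L f = 0 := by
  have := h f
  simp only [h0, mul_zero] at this
  exact this.unique hasSum_zero

theorem isModeSummable_twoPoint_left (n : ℕ) (g : CircleTest) :
    IsModeSummable n fun f => twoPoint n f g := fun f => by
  have hinj : Function.Injective fun r : ℕ => (r + (2 * n + 1 : ℕ) : ℤ) := fun a b hab => by
    simpa using hab
  rw [← hinj.hasSum_iff]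
  · convert! hasSum_twoPoint n f g using 2 with r
    simp only [Function.comp_apply]
    rw [show (r + (2 * n + 1 : ℕ) - n : ℤ) = r + n + 1 by push_cast; ring, twoPoint_mode_left]
    ring
  · intro s hs
    refine mul_eq_zero_of_right _ (twoPoint_mode_left_of_le ?_ g)
    by_contra h
    exact hs ⟨(s - (2 * n + 1)).toNat, by simp only []; omega⟩

theorem isModeSummable_twoPoint_right (n : ℕ) (f : CircleTest) :
    IsModeSummable n fun g => twoPoint n f g := fun g => by
  have hinj : Function.Injective fun r : ℕ => (-1 - r : ℤ) := fun a b hab => by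
    simpa using hab
  rw [← hinj.hasSum_iff]
  · convert! hasSum_twoPoint n f g using 2 with r
    simp only [Function.comp_apply]
    rw [show (-1 - r - n : ℤ) = -r - n - 1 by ring, twoPoint_mode_right]
    ring
  · intro s hs
    refine mul_eq_zero_of_right _ (twoPoint_mode_right_of_le ?_ f)
    by_contra h
    exact hs ⟨(-1 - s).toNat, by simp only []; omega⟩

/-! ### The field on the Fock space -/

/-- The annihilation part of the field, as a derivation. -/
def annihilationDerivation (n : ℕ) (f : CircleTest) : Derivation ℂ PreFock PreFock :=
  MvPolynomial.mkDerivation ℂ fun g : CircleTest => (MvPolynomial.C (twoPoint n f g) : PreFock)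

/-- The conformal Hamiltonian, as a derivation. -/
def hamiltonianDerivation (n : ℕ) : Derivation ℂ PreFock PreFock :=
  MvPolynomial.mkDerivation ℂ fun f : CircleTest =>
    (MvPolynomial.X (testHamiltonian n f) : PreFock)

theorem annihilationDerivation_X (n : ℕ) (f g : CircleTest) :
    annihilationDerivation n f (MvPolynomial.X g) = MvPolynomial.C (twoPoint n f g) :=
  MvPolynomial.mkDerivation_X _ _ _

theorem hamiltonianDerivation_X (n : ℕ) (f : CircleTest) :
    hamiltonianDerivation n (MvPolynomial.X f) = MvPolynomial.X (testHamiltonian n f) :=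
  MvPolynomial.mkDerivation_X _ _ _

theorem preField_apply (n : ℕ) (f : CircleTest) (v : PreFock) :
    preField n f v = MvPolynomial.X f * v + annihilationDerivation n f v := rfl

theorem preHamiltonian_apply (n : ℕ) (v : PreFock) :
    preHamiltonian n v = hamiltonianDerivation n v := rfl

theorem derivation_C (D : Derivation ℂ PreFock PreFock) (c : ℂ) : D (MvPolynomial.C c) = 0 :=
  D.map_algebraMap c

theorem annihilationDerivation_comm (n : ℕ) (f g : CircleTest) (v : PreFock) :
    annihilationDerivation n f (annihilationDerivation n g v) =
      annihilationDerivation n g (annihilationDerivation n f v) := by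
  have h : ⁅annihilationDerivation n f, annihilationDerivation n g⁆ = 0 := by
    refine MvPolynomial.derivation_ext fun h => ?_
    rw [Derivation.commutator_apply, annihilationDerivation_X, annihilationDerivation_X,
      derivation_C, derivation_C, sub_zero, Derivation.zero_apply]
  have h2 := congrArg (fun D : Derivation ℂ PreFock PreFock => D v) h
  simp only [Derivation.commutator_apply, Derivation.zero_apply] at h2
  exact sub_eq_zero.1 h2

theorem preField_commutator (n : ℕ) (f g : CircleTest) (v : PreFock) :
    preField n f (preField n g v) =
      preField n g (preField n f v) + (twoPoint n f g - twoPoint n g f) • v := by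
  simp only [preField_apply, map_add, Derivation.leibniz, annihilationDerivation_X, smul_eq_mul]
  rw [annihilationDerivation_comm n f g, MvPolynomial.smul_eq_C_mul, map_sub]
  ring

/-- The field satisfies the light-ray commutation relation. -/
theorem obeysLightRayCCR_field (n : ℕ) : ObeysLightRayCCR n (field n) := by
  intro f g
  rw [← twoPoint_sub_twoPoint]
  refine LinearMap.ext fun v => ?_
  obtain ⟨v, rfl⟩ := (nullSpace n).mkQ_surjective v
  simp only [LinearMap.sub_apply, Module.End.mul_apply, Module.algebraMap_end_apply, field,
    Submodule.mkQ_apply, Submodule.mapQ_apply]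
  rw [preField_commutator, Submodule.Quotient.mk_add, add_sub_cancel_left,
    Submodule.Quotient.mk_smul]

theorem hamiltonianDerivation_preField (n : ℕ) (f : CircleTest) (v : PreFock) :
    hamiltonianDerivation n (preField n f v) =
      preField n f (hamiltonianDerivation n v) + preField n (testHamiltonian n f) v := by
  have h : ⁅hamiltonianDerivation n, annihilationDerivation n f⁆ =
      annihilationDerivation n (testHamiltonian n f) := by
    refine MvPolynomial.derivation_ext fun g => ?_
    rw [Derivation.commutator_apply, annihilationDerivation_X, hamiltonianDerivation_X,
      annihilationDerivation_X, annihilationDerivation_X, derivation_C,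
      twoPoint_testHamiltonian_left, map_neg, zero_sub]
  have h2 := congrArg (fun D : Derivation ℂ PreFock PreFock => D v) h
  simp only [Derivation.commutator_apply] at h2
  simp only [preField_apply, map_add, Derivation.leibniz, hamiltonianDerivation_X, smul_eq_mul]
  rw [← h2]
  ring

theorem constantCoeff_hamiltonianDerivation (n : ℕ) (v : PreFock) :
    MvPolynomial.constantCoeff (hamiltonianDerivation n v) = 0 := by
  induction v using MvPolynomial.induction_on with
  | C c => rw [derivation_C, map_zero]
  | add p q hp hq => rw [map_add, map_add, hp, hq, add_zero]
  | mul_X p f hp =>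
    rw [Derivation.leibniz, hamiltonianDerivation_X, map_add, smul_eq_mul, smul_eq_mul, map_mul,
      map_mul, MvPolynomial.constantCoeff_X, MvPolynomial.constantCoeff_X, zero_mul, mul_zero,
      add_zero]

/-- One-particle vectors orthogonal to all one-particle vectors generate an ideal of null
vectors. -/
theorem mul_mem_nullSpace {n : ℕ} {y : PreFock} (hy : MvPolynomial.constantCoeff y = 0)
    (ha : ∀ f, annihilationDerivation n f y = 0) (v : PreFock) : y * v ∈ nullSpace n := by
  intro l
  have h : (l.map (preField n)).prod (y * v) = y * (l.map (preField n)).prod v := by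
    induction l with
    | nil => rfl
    | cons f l ih =>
      simp only [List.map_cons, List.prod_cons, Module.End.mul_apply]
      rw [ih, preField_apply, preField_apply, Derivation.leibniz, ha, smul_zero, add_zero,
        smul_eq_mul]
      ring
  rw [h, map_mul, hy, zero_mul]

/-- The field is homogeneous in the test function up to null vectors. -/
theorem preField_smul_sub_mem (n : ℕ) (c : ℂ) (f : CircleTest) (v : PreFock) :
    preField n (c • f) v - c • preField n f v ∈ nullSpace n := by
  have h : annihilationDerivation n (c • f) = c • annihilationDerivation n f := by
    refine MvPolynomial.derivation_ext fun g => ?_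
    rw [Derivation.smul_apply, annihilationDerivation_X, annihilationDerivation_X,
      twoPoint_smul_left, MvPolynomial.smul_eq_C_mul, map_mul]
  have h2 : preField n (c • f) v - c • preField n f v =
      (MvPolynomial.X (c • f) - c • MvPolynomial.X f : PreFock) * v := by
    rw [preField_apply, preField_apply, h, Derivation.smul_apply, smul_add, sub_mul, smul_mul_assoc]
    abel
  rw [h2]
  refine mul_mem_nullSpace ?_ (fun g => ?_) v
  · rw [MvPolynomial.smul_eq_C_mul, map_sub, map_mul, MvPolynomial.constantCoeff_X,
      MvPolynomial.constantCoeff_X, mul_zero, sub_zero]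
  · rw [map_sub, Derivation.map_smul, annihilationDerivation_X, annihilationDerivation_X,
      twoPoint_smul_right, MvPolynomial.smul_eq_C_mul, map_mul, sub_self]

theorem testHamiltonian_modeFunction (n : ℕ) (m : ℤ) :
    testHamiltonian n (modeFunction n m) = (-m : ℂ) • modeFunction n m := by
  apply Subtype.ext
  funext z
  have h := hasSum_circleCoeff (testHamiltonian n (modeFunction n m)) z
  have h2 := (hasSum_circleCoeff (modeFunction n m) z).mul_left (-m : ℂ)
  refine h.unique ?_
  convert! h2 using 2 with s
  rw [circleCoeff_testHamiltonian, circleCoeff_modeFunction]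
  by_cases hs : s = n + m
  · rw [if_pos hs, hs]
    push_cast
    ring
  · rw [if_neg hs]
    ring

/-! ### Absence of the energies `1, …, n` -/

/-- The vacuum correlation `⟨Ω, Φ (f₁) ⋯ Φ (f_k) v⟩`. -/
def correlation (n : ℕ) (v : PreFock) (l : List CircleTest) : ℂ :=
  MvPolynomial.constantCoeff ((l.map (preField n)).prod v)

theorem correlation_swap (n : ℕ) (v : PreFock) (l₁ l₂ : List CircleTest) (f g : CircleTest) :
    correlation n v (l₁ ++ f :: g :: l₂) = correlation n v (l₁ ++ g :: f :: l₂) +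
      (twoPoint n f g - twoPoint n g f) * correlation n v (l₁ ++ l₂) := by
  simp only [correlation, List.map_append, List.map_cons, List.prod_append, List.prod_cons,
    Module.End.mul_apply]
  rw [preField_commutator, map_add, map_add, map_smul, MvPolynomial.smul_eq_C_mul, map_mul,
    MvPolynomial.constantCoeff_C]

theorem correlation_cons (n : ℕ) (v : PreFock) (f : CircleTest) (l : List CircleTest) :
    correlation n v (f :: l) = MvPolynomial.constantCoeff
      (annihilationDerivation n f ((l.map (preField n)).prod v)) := by
  simp only [correlation, List.map_cons, List.prod_cons, Module.End.mul_apply]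
  rw [preField_apply, map_add, map_mul, MvPolynomial.constantCoeff_X, zero_mul, zero_add]

/-- The creation operators, `m < - n`, and the central modes, `|m| ≤ n`, annihilate the vacuum to the
left. -/
theorem correlation_mode_cons {n : ℕ} {m : ℤ} (hm : m ≤ n) (v : PreFock) (l : List CircleTest) :
    correlation n v (modeFunction n m :: l) = 0 := by
  have h : annihilationDerivation n (modeFunction n m) = 0 := by
    refine MvPolynomial.derivation_ext fun g => ?_
    rw [annihilationDerivation_X, twoPoint_mode_left_of_le hm, map_zero, Derivation.zero_apply]
  rw [correlation_cons, h, Derivation.zero_apply, map_zero]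

/-- A vacuum correlation may be evaluated term by term in the Fourier series of each test
function. -/
theorem isModeSummable_correlation (n : ℕ) (v : PreFock) (l₁ l₂ : List CircleTest) :
    IsModeSummable n fun f => correlation n v (l₁ ++ f :: l₂) := by
  induction l₁ using List.reverseRecOn generalizing l₂ with
  | nil =>
    simp only [List.nil_append, correlation_cons]
    generalize (l₂.map (preField n)).prod v = w
    induction w using MvPolynomial.induction_on with
    | C c => simpa only [derivation_C, map_zero] using IsModeSummable.zero n
    | add p q hp hq => simpa only [map_add] using hp.add hq
    | mul_X p g hp =>
      simpa only [Derivation.leibniz, annihilationDerivation_X, smul_eq_mul, map_add, map_mul,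
        MvPolynomial.constantCoeff_X, MvPolynomial.constantCoeff_C, zero_mul, add_zero] using
        (isModeSummable_twoPoint_left n g).const_mul (MvPolynomial.constantCoeff p)
  | append_singleton l₁ a ih =>
    have h := (ih (a :: l₂)).add (((isModeSummable_twoPoint_right n a).add
      ((isModeSummable_twoPoint_left n a).const_mul (-1))).const_mul (correlation n v (l₁ ++ l₂)))
    have e (f : CircleTest) : correlation n v (l₁ ++ [a] ++ f :: l₂) =
        correlation n v (l₁ ++ f :: a :: l₂) + correlation n v (l₁ ++ l₂) *
          (twoPoint n a f + -1 * twoPoint n f a) := by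
      rw [List.append_assoc, List.singleton_append, correlation_swap]
      ring
    simpa only [e] using h

/-- The energy carried by a product of modes, up to null vectors. -/
theorem hamiltonianDerivation_modes_mem (n : ℕ) (v : PreFock) (l : List ℤ) :
    hamiltonianDerivation n (((l.map (modeFunction n)).map (preField n)).prod v) -
      ((l.map (modeFunction n)).map (preField n)).prod (hamiltonianDerivation n v) +
      (l.sum : ℂ) • ((l.map (modeFunction n)).map (preField n)).prod v ∈ nullSpace n := by
  induction l with
  | nil => simp
  | cons m l ih =>
    simp only [List.map_cons, List.prod_cons, Module.End.mul_apply, List.sum_cons]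
    set w := ((l.map (modeFunction n)).map (preField n)).prod v
    have h1 := preField_mem_nullSpace n (modeFunction n m) ih
    have h2 := preField_smul_sub_mem n (-m : ℂ) (modeFunction n m) w
    convert! (nullSpace n).add_mem h1 h2 using 1
    rw [hamiltonianDerivation_preField, testHamiltonian_modeFunction]
    simp only [map_add, map_sub, map_smul, Int.cast_add]
    module

/-- A vector of energy `E` has no correlations with modes of a different total energy. -/
theorem correlation_modes_mul_eq {n : ℕ} {v : PreFock} {E : ℂ}
    (hv : preHamiltonian n v - E • v ∈ nullSpace n) (l : List ℤ) :
    (l.sum : ℂ) * correlation n v (l.map (modeFunction n)) =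
      E * correlation n v (l.map (modeFunction n)) := by
  have h1 := hamiltonianDerivation_modes_mem n v l []
  have h2 := hv (l.map (modeFunction n))
  rw [preHamiltonian_apply, map_sub, map_smul, map_sub, MvPolynomial.smul_eq_C_mul, map_mul,
    MvPolynomial.constantCoeff_C] at h2
  simp only [List.map_nil, List.prod_nil, Module.End.one_apply] at h1
  rw [map_add, map_sub, MvPolynomial.smul_eq_C_mul, map_mul, MvPolynomial.constantCoeff_C,
    constantCoeff_hamiltonianDerivation] at h1
  rw [correlation]
  linear_combination h1 + h2

theorem exists_le_or_lt_sum (n : ℤ) (hn : 0 ≤ n) (l : List ℤ) :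
    (∃ m ∈ l, m ≤ n) ∨ l = [] ∨ n < l.sum := by
  induction l with
  | nil => exact Or.inr (Or.inl rfl)
  | cons a l ih =>
    rcases le_or_gt a n with ha | ha
    · exact Or.inl ⟨a, List.mem_cons_self, ha⟩
    rcases ih with ⟨m, hm, hmn⟩ | rfl | h
    · exact Or.inl ⟨m, List.mem_cons_of_mem _ hm, hmn⟩
    · exact Or.inr (Or.inr (by simpa using ha))
    · refine Or.inr (Or.inr ?_)
      rw [List.sum_cons]
      omega

/-- Normal ordering: a mode which annihilates the vacuum to the left may be moved there, at the
expense of correlations of shorter products of modes. -/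
theorem correlation_modes_append_cons {n : ℕ} {v : PreFock} {N : ℕ}
    (ih : ∀ l : List ℤ, l.length < N → correlation n v (l.map (modeFunction n)) = 0)
    {m : ℤ} (hm : m ≤ n) (l₁ l₂ : List ℤ) (hN : l₁.length + l₂.length < N) :
    correlation n v ((l₁ ++ m :: l₂).map (modeFunction n)) = 0 := by
  induction l₁ using List.reverseRecOn generalizing l₂ with
  | nil => exact correlation_mode_cons hm v _
  | append_singleton l₁ a ih' =>
    rw [List.length_append, List.length_singleton] at hN
    have h1 := ih' (a :: l₂) (by rw [List.length_cons]; omega)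
    have h2 := ih (l₁ ++ l₂) (by rw [List.length_append]; omega)
    simp only [List.map_append, List.map_cons, List.append_assoc,
      List.singleton_append] at h1 h2 ⊢
    rw [correlation_swap, h1, h2, mul_zero, add_zero]

theorem correlation_modes_eq_zero {n : ℕ} {v : PreFock} {k : ℕ} (hk : 1 ≤ k) (hkn : k ≤ n)
    (hv : preHamiltonian n v - (k : ℂ) • v ∈ nullSpace n) (N : ℕ) (l : List ℤ)
    (hl : l.length = N) : correlation n v (l.map (modeFunction n)) = 0 := by
  induction N using Nat.strong_induction_on generalizing l with
  | _ N ih =>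
    rcases exists_le_or_lt_sum n (by omega) l with ⟨m, hm, hmn⟩ | hsum
    · obtain ⟨l₁, l₂, rfl⟩ := List.append_of_mem hm
      rw [List.length_append, List.length_cons] at hl
      exact correlation_modes_append_cons (fun l' hl' => ih _ hl' l' rfl) hmn l₁ l₂ (by omega)
    · have hne : l.sum ≠ k := by
        rcases hsum with rfl | h
        · rw [List.sum_nil]; omega
        · omega
      have h := correlation_modes_mul_eq hv l
      by_contra h0
      exact hne (by exact_mod_cast mul_right_cancel₀ h0 h)

theorem energyEigenspace_eq_bot {n k : ℕ} (hk : 1 ≤ k) (hkn : k ≤ n) :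
    energyEigenspace n (k : ℂ) = ⊥ := by
  rw [eq_bot_iff]
  rintro _ ⟨v, hv, rfl⟩
  have hv' : preHamiltonian n v - (k : ℂ) • v ∈ nullSpace n := hv
  -- The modes among the test functions are replaced by arbitrary ones from right to left.
  have key (l : List CircleTest) (l' : List ℤ) :
      correlation n v (l'.map (modeFunction n) ++ l) = 0 := by
    induction l generalizing l' with
    | nil => rw [List.append_nil]; exact correlation_modes_eq_zero hk hkn hv' _ l' rfl
    | cons f l ih =>
      refine (isModeSummable_correlation n v (l'.map (modeFunction n)) l).eq_zero (fun m => ?_) f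
      simpa using ih (l' ++ [m])
  rw [Submodule.mem_bot, Submodule.mkQ_apply, Submodule.Quotient.mk_eq_zero]
  exact fun l => key l []

end DerivativeField

end

theorem proposition1 (n : ℕ) :
    -- the field satisfies the light-ray commutation relation
    DerivativeField.ObeysLightRayCCR n (DerivativeField.field n) ∧
    -- the commutation relations of its modes
    (∀ m m' : ℤ,
      DerivativeField.field n (DerivativeField.modeFunction n m) *
          DerivativeField.field n (DerivativeField.modeFunction n m') -
        DerivativeField.field n (DerivativeField.modeFunction n m') *
          DerivativeField.field n (DerivativeField.modeFunction n m) =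
      if m = -m' then
        algebraMap ℂ (Module.End ℂ (DerivativeField.WightmanDomain n))
          (DerivativeField.modePolynomial n m : ℂ)
      else 0) ∧
    -- the modes with `|m| ≤ n` are central
    (∀ m : ℤ, |m| ≤ (n : ℤ) →
      ∀ a ∈ Algebra.adjoin ℂ (Set.range (DerivativeField.field n)),
        Commute (DerivativeField.field n (DerivativeField.modeFunction n m)) a) ∧
    -- the eigenspaces of the conformal Hamiltonian for the energies `1, …, n` are null
    (∀ k : ℕ, 1 ≤ k → k ≤ n → DerivativeField.energyEigenspace n (k : ℂ) = ⊥) ∧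
    -- the commutation relations and centrality hold in every representation
    (∀ (A : Type*) [Ring A] [Algebra ℂ A] (Φ : DerivativeField.CircleTest → A),
      DerivativeField.ObeysLightRayCCR n Φ →
      (∀ m m' : ℤ,
        Φ (DerivativeField.modeFunction n m) * Φ (DerivativeField.modeFunction n m') -
          Φ (DerivativeField.modeFunction n m') * Φ (DerivativeField.modeFunction n m) =
        if m = -m' then algebraMap ℂ A (DerivativeField.modePolynomial n m : ℂ) else 0) ∧
      (∀ m : ℤ, |m| ≤ (n : ℤ) → ∀ a ∈ Algebra.adjoin ℂ (Set.range Φ),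
        Commute (Φ (DerivativeField.modeFunction n m)) a)) := by
  have h := DerivativeField.obeysLightRayCCR_field n
  exact ⟨h, h.modes, fun m hm a ha => h.commute hm ha,
    fun k hk hkn => DerivativeField.energyEigenspace_eq_bot hk hkn,
    fun A _ _ Φ hΦ => ⟨hΦ.modes, fun m hm a ha => hΦ.commute hm ha⟩⟩
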